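/- Consider $k$ identical units and $n$ unit-demand agents with valuation profile $v=(v_1,\dots,v_n)\in[0,\infty)^n$ (with $n,k\ge 0$ integers). **Optimal mechanisms and benchmark.** Let $F$ be a distribution on $[0,\infty)$ with finite mean whose support is a closed interval (bounded or unbounded above) and which has a density $f$ that is positive on this interval. Put $\vartheta(z)=\frac{1-F(z)}{f(z)}$, $H(x)=\int_0^x\vartheta(F^{-1}(r))\,dr$ for $x\in[0,1]$, let $\hat H$ be the largest convex function on $[0,1]$ with $\hat H\le H$, let $g$ be the right derivative of $\hat H$ on $[0,1)$ and $g(1)$ the left derivative of $\hat H$ at $1$, and let $\bar\vartheta(z)=g(F(z))$ (the ironed virtual valuation for utility). The mechanism $\mathrm{Mye}_F$ picks the set $W$ of winners uniformly at random among the sets of $\min(k,n)$ agents that maximize $\sum_{i\in W}\bar\vartheta(v_i)$ over all sets of at most $k$ agents. If $x_i(v)$ is the probability that $i$ wins and $\pi_i(v)=v_ix_i(v)-\int_0^{v_i}x_i(z,v_{-i})\,dz$, then a winner $i$ is charged $\pi_i(v)/x_i(v)$ and a loser is charged $0$. The residual surplus of an outcome is the expected sum over winners of valuation minus payment; $\mathrm{Mye}_F(v)$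 also denotes the residual surplus of $\mathrm{Mye}_F$ on $v$. Let $\mathcal G(v)=\sup_F\mathrm{Mye}_F(v)$. **Lotteries.** For $p\ge 0$, the $k$-unit $p$-lottery serves the agents with value at least $p$ at price $p$; if there are more than $k$ of them, $k$ of them are chosen uniformly at random. Its residual surplus is $L_p(v)$. For $0\le q\le p$, let $S$ be the set of agents with value in $(p,\infty)$, $T$ the set of agents with value in $(q,p]$, $s=|S|$, $t=|T|$. The $k$-unit $(p,q)$-lottery is the following: (1) if $s>k$, $k$ uniformly random agents of $S$ win at price $p$; (2) if $s+t\le k$, all agents of $S\cup T$ win at price $q$; (3) otherwise each agent of $S$ wins at price $\frac{k-s+1}{t+1}q+\frac{s+t-k}{t+1}p$, and $k-s$ uniformly random agents of $T$ win at price $q$. Its residual surplus is $L_{p,q}(v)$. **Claim.** For every $n$, $k$ and $v$: (a) For every $F$ as above there are $0\le q\le p$ such that $\mathrm{Mye}_F$ on $v$ has the same random set of winners, and the same prices for the agents who can win, as the $k$-unit $(p,q)$-lottery on $v$, where agents whose value is exactly $p$ or exactly $q$ may have to be put on the other side of that threshold (agents with equal values being treated alike). (b) $\mathcal G(v)$ is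 finite, and there are $0\le q\le p$ with $L_{p,q}(v)=\mathcal G(v)$. (c) For all $0\le q\le p$: $L_{p,q}(v)\le L_{p,p}(v)+L_{q,q}(v)$, where $L_{p,p}(v)$ and $L_{q,q}(v)$ are the residual surpluses of the single-price lotteries restricted to the agents with value strictly above the price. In particular $L_{p,q}(v)\le L_p(v)+L_q(v)$ if no agent has value exactly $p$ or $q$. In all cases there is $p'\ge 0$ with $L_{p'}(v)\ge\frac12 L_{p,q}(v)$. (d) There is $p\ge 0$ such that the $k$-unit $p$-lottery has residual surplus $L_p(v)\ge\mathcal G(v)/2$. -/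

import Mathlib

namespace MoneyBurning

noncomputable section

/-! ### The common prior and its ironed virtual valuation for utility -/

/-- A distribution of a nonnegative valuation with finite mean whose support is a closed interval,
bounded (`[a, b]`) or not (`[a, ∞)`), with positive density throughout this interval. -/
structure Prior where
  density : ℝ → ℝ
  support : Set ℝ
  isClosed_support : IsClosed support
  ordConnected_support : support.OrdConnected
  support_nonneg : ∀ z ∈ support, 0 ≤ z
  measurable_density : Measurable density
  density_pos : ∀ z ∈ support, 0 < density z
  density_eq_zero : ∀ z, z ∉ support → density z = 0
  integrable_density : MeasureTheory.Integrable density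
  integral_density : ∫ z, density z = 1
  integrable_mean : MeasureTheory.Integrable (fun z => z * density z)

namespace Prior

/-- The cumulative distribution function `F`. -/
def cdf (D : Prior) (z : ℝ) : ℝ := ∫ t in Set.Iic z, D.density t

/-- The inverse `F⁻¹` of the distribution function; on `(0, 1)` it is the inverse of the strictly
increasing continuous function `F` restricted to the support. -/
def quantile (D : Prior) (q : ℝ) : ℝ := sInf {z | z ∈ D.support ∧ q ≤ D.cdf z}

/-- The virtual valuation for utility, `(1 - F(z)) / f(z)`. -/
def virtualValue (D : Prior) (z : ℝ) : ℝ := (1 - D.cdf z) / D.density z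

/-- `H(q) = ∫₀^q h(r) dr` with `h(r) = ϑ(F⁻¹(r))`. -/
def cumulative (D : Prior) (q : ℝ) : ℝ := ∫ r in (0 : ℝ)..q, D.virtualValue (D.quantile r)

/-- The convex hull of `H`: the largest convex function on `[0, 1]` bounded above by `H`, as the
pointwise supremum of all convex functions bounded above by `H`. -/
def hull (D : Prior) (q : ℝ) : ℝ :=
  sSup {y | ∃ φ : ℝ → ℝ, ConvexOn ℝ (Set.Icc 0 1) φ ∧
    (∀ r ∈ Set.Icc (0 : ℝ) 1, φ r ≤ D.cumulative r) ∧ y = φ q}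

/-- The right-continuous derivative of the convex hull on `[0, 1)`, i.e. its right derivative;
at the right end point `1` it is the left derivative. -/
def hullSlope (D : Prior) (q : ℝ) : ℝ :=
  if q < 1 then derivWithin D.hull (Set.Icc q 1) q else derivWithin D.hull (Set.Icc 0 1) 1

/-- The ironed virtual valuation for utility. -/
def ironedValue (D : Prior) (z : ℝ) : ℝ := D.hullSlope (D.cdf z)

end Prior

/-! ### Outcomes of randomized mechanisms on a fixed valuation profile -/

/-- The probability that agent `i` wins when the set of winners is drawn uniformly at random
from the family `𝒲`. -/
def winProb {n : ℕ} (𝒲 : Finset (Finset (Fin n))) (i : Fin n) : ℝ :=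
  ((𝒲.filter (fun W => i ∈ W)).card : ℝ) / (𝒲.card : ℝ)

/-- A randomized outcome: the set of winners is drawn uniformly at random from `winners`, every
winner `i` is charged `price i`, and losers are charged nothing. -/
structure Outcome (n : ℕ) where
  winners : Finset (Finset (Fin n))
  price : Fin n → ℝ

/-- The expected residual surplus: the expectation of the sum, over the winners, of valuation
minus (burnt) payment. -/
def Outcome.surplus {n : ℕ} (o : Outcome n) (v : Fin n → ℝ) : ℝ :=
  (∑ W ∈ o.winners, ∑ i ∈ W, (v i - o.price i)) / (o.winners.card : ℝ)

/-- Two outcomes coincide: the random set of winners has the same law, and every agent who can win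
is charged the same price on winning. -/
def Outcome.Same {n : ℕ} (o o' : Outcome n) : Prop :=
  o.winners = o'.winners ∧ ∀ W ∈ o.winners, ∀ i ∈ W, o.price i = o'.price i

/-! ### The Bayesian optimal mechanism and the benchmark -/

open Classical in
/-- The winner sets in a `k`-unit auction among which the mechanism optimal for `D` randomizes
uniformly: all units are awarded (to the extent that there are agents), and the ironed virtual
surplus is maximum among all feasible allocations. -/
def myeWinners {n : ℕ} (D : Prior) (k : ℕ) (v : Fin n → ℝ) : Finset (Finset (Fin n)) :=
  Finset.univ.filter fun W => W.card = min k n ∧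
    ∀ W' : Finset (Fin n), W'.card ≤ k →
      ∑ i ∈ W', D.ironedValue (v i) ≤ ∑ i ∈ W, D.ironedValue (v i)

/-- The allocation rule: the probability that agent `i` wins on the profile `v`. -/
def myeAlloc {n : ℕ} (D : Prior) (k : ℕ) (v : Fin n → ℝ) (i : Fin n) : ℝ :=
  winProb (myeWinners D k v) i

/-- The expected payment given by the payment identity
`pᵢ(v) = vᵢ xᵢ(v) - ∫₀^{vᵢ} xᵢ(z, v₋ᵢ) dz`. -/
def myePayment {n : ℕ} (D : Prior) (k : ℕ) (v : Fin n → ℝ) (i : Fin n) : ℝ :=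
  v i * myeAlloc D k v i - ∫ z in (0 : ℝ)..v i, myeAlloc D k (Function.update v i z) i

/-- The symmetric optimal mechanism for `D`, run on the profile `v`. Winner `i` is charged
`pᵢ(v) / xᵢ(v)`. -/
def mye {n : ℕ} (D : Prior) (k : ℕ) (v : Fin n → ℝ) : Outcome n where
  winners := myeWinners D k v
  price i := myePayment D k v i / myeAlloc D k v i

/-- The benchmark: the supremum, over all priors, of the expected residual surplus of the
symmetric optimal mechanism for this prior on the profile `v`. -/
def benchmark {n : ℕ} (k : ℕ) (v : Fin n → ℝ) : ℝ :=
  ⨆ D : Prior, (mye D k v).surplus v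

/-! ### Lotteries -/

/-- The lottery of `m` units at price `p` among the agents in `A`: if there are more than `m` such
agents, `m` winners are selected uniformly at random, otherwise all of them win. -/
def lotteryOn {n : ℕ} (m : ℕ) (A : Finset (Fin n)) (p : ℝ) : Outcome n where
  winners := A.powersetCard (min m A.card)
  price _ := p

/-- The `k`-unit `p`-lottery, among the agents with value at least `p`. -/
def pLottery {n : ℕ} (k : ℕ) (p : ℝ) (v : Fin n → ℝ) : Outcome n :=
  lotteryOn k (Finset.univ.filter fun i => p ≤ v i) p

/-- The two-price lottery with priority agents `S` and second-class agents `T`.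
* If `S` has more than `k` agents, run a `k`-unit `p`-lottery on `S`.
* If `S ∪ T` has at most `k` agents, sell to all of them at price `q`.
* Otherwise each agent of `S` gets a unit at the incentive compatible price, and the remaining
  units are given by a lottery at price `q` among `T`. -/
def twoPriceOn {n : ℕ} (k : ℕ) (S T : Finset (Fin n)) (p q : ℝ) : Outcome n :=
  if k < S.card then lotteryOn k S p
  else if S.card + T.card ≤ k then { winners := {S ∪ T}, price := fun _ => q }
  else
    { winners := (lotteryOn (k - S.card) T q).winners.image (fun W => S ∪ W)
      price := fun i =>
        if i ∈ S then
          ((k : ℝ) - S.card + 1) / ((T.card : ℝ) + 1) * q +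
            ((S.card : ℝ) + T.card - k) / ((T.card : ℝ) + 1) * p
        else q }

/-- The `k`-unit `(p,q)`-lottery: the priority agents are those with value in `(p, ∞)`, the
second-class agents those with value in `(q, p]`. -/
def pqLottery {n : ℕ} (k : ℕ) (p q : ℝ) (v : Fin n → ℝ) : Outcome n :=
  twoPriceOn k (Finset.univ.filter fun i => p < v i)
    (Finset.univ.filter fun i => q < v i ∧ v i ≤ p) p q

/-- `S` and `T` are the two classes of agents for the thresholds `p` and `q`, up to the treatment
of agents whose value equals a threshold, who may be put on either side of it (agents with equal
values being treated alike). If no value equals `p` or `q`, then `S` is the set of agents with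
value in `(p, ∞)` and `T` the set of those with value in `(q, p]`. -/
structure IsSplit {n : ℕ} (v : Fin n → ℝ) (p q : ℝ) (S T : Finset (Fin n)) : Prop where
  disjoint : Disjoint S T
  mem_of_gt_p : ∀ i, p < v i → i ∈ S
  ge_p_of_mem : ∀ i ∈ S, p ≤ v i
  mem_of_gt_q : ∀ i, q < v i → i ∈ S ∪ T
  ge_q_of_mem : ∀ i ∈ S ∪ T, q ≤ v i
  symm : ∀ i j, v i = v j → ((i ∈ S ↔ j ∈ S) ∧ (i ∈ T ↔ j ∈ T))

end

end MoneyBurning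

/-!
For a fixed prior the ironed virtual valuation is nondecreasing. Let `d` be the level at which the
`k` units run out. The bids at level `d` form an interval with endpoints `q ≤ p`, so the
allocation of an agent is a step function of the agent's bid which jumps at `q` and `p`, and the
payment identity yields the prices of the two-price lottery with these thresholds.

Moving the agents at a threshold to the lower class only raises the surplus, hence the benchmark is
at most the maximum of `L_{p,q}`, which is attained because `L_{p,q}` is upper semicontinuous and a
price above all values may be replaced by the largest value. Since `L_{p,q}` is also
right-continuous and vanishes for `p = q` above all values, it takes every value between `0` and its
maximum, in particular the benchmark.

Writing `v - q = (v - p) + (p - q)` for the priority agents gives `L_{p,q} ≤ L_{p,p} + L_{q,q}`. The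
inequality is strict if `L_{p,p} > 0`, so even if some values equal a threshold, a price slightly
above `p` or `q` obtains half of `L_{p,q}`.
-/

namespace MoneyBurning

open Filter Topology MeasureTheory
open scoped Finset

/-! ### Winning probabilities -/

section WinProb

variable {n m : ℕ} {i : Fin n} {𝒲 : Finset (Finset (Fin n))}

theorem Outcome.surplus_eq_sum_winProb (o : Outcome n) (v : Fin n → ℝ) :
    o.surplus v = ∑ i, winProb o.winners i * (v i - o.price i) := by
  have sum_eq : ∑ W ∈ o.winners, ∑ i ∈ W, (v i - o.price i)
      = ∑ i, (#{W ∈ o.winners | i ∈ W} : ℝ) * (v i - o.price i) := by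
    calc ∑ W ∈ o.winners, ∑ i ∈ W, (v i - o.price i)
        = ∑ i, ∑ W ∈ o.winners with i ∈ W, (v i - o.price i) :=
          Finset.sum_comm' fun W i => by simp
      _ = _ := by simp only [Finset.sum_const, nsmul_eq_mul]
  rw [Outcome.surplus, sum_eq, Finset.sum_div]
  exact Finset.sum_congr rfl fun i _ => by rw [winProb]; ring

theorem Outcome.Same.surplus_eq {o o' : Outcome n} (h : o.Same o') (v : Fin n → ℝ) :
    o.surplus v = o'.surplus v := by
  rw [Outcome.surplus, Outcome.surplus, ← h.1]
  congr 1
  exact Finset.sum_congr rfl fun W hW => Finset.sum_congr rfl fun i hi => by rw [h.2 W hW i hi]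

theorem winProb_eq_zero (h : ∀ W ∈ 𝒲, i ∉ W) : winProb 𝒲 i = 0 := by
  rw [winProb, Finset.filter_false_of_mem h, Finset.card_empty, Nat.cast_zero, zero_div]

theorem winProb_eq_one (hne : 𝒲.Nonempty) (h : ∀ W ∈ 𝒲, i ∈ W) : winProb 𝒲 i = 1 := by
  rw [winProb, Finset.filter_true_of_mem h, div_self]
  exact_mod_cast hne.card_ne_zero

theorem winProb_powersetCard {A : Finset (Fin n)} (hm : m ≤ #A) (hi : i ∈ A) :
    winProb (A.powersetCard m) i = (m : ℝ) / #A := by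
  rcases Nat.eq_zero_or_pos m with rfl | hm0
  · simp [winProb, Finset.filter_singleton]
  have card_filter : #{W ∈ A.powersetCard m | i ∈ W} = (#A - 1).choose (m - 1) := by
    simpa using Finset.card_filter_powersetCard_subset {i} A m (by simpa using hi) (by simpa)
  rw [winProb, card_filter, Finset.card_powersetCard]
  obtain ⟨l, rfl⟩ : ∃ l, m = l + 1 := ⟨m - 1, by omega⟩
  obtain ⟨a, ha⟩ : ∃ a, #A = a + 1 := ⟨#A - 1, by omega⟩
  rw [ha] at hm ⊢
  have choose_pos : 0 < (a + 1).choose (l + 1) := Nat.choose_pos hm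
  rw [Nat.add_sub_cancel, Nat.add_sub_cancel, div_eq_div_iff (by positivity) (by positivity)]
  exact_mod_cast (mul_comm _ _).trans ((Nat.add_one_mul_choose_eq a l).trans (mul_comm _ _))

end WinProb

section PriorityWinners

variable {ι : Type*} [DecidableEq ι] {m : ℕ} {S T : Finset ι}

/-- The possible sets of winners when all agents of `S` win and `m` further units are allotted
among the agents of `T`. -/
def priorityWinners (m : ℕ) (S T : Finset ι) : Finset (Finset ι) :=
  (T.powersetCard m).image (S ∪ ·)

theorem priorityWinners_nonempty (hm : m ≤ #T) : (priorityWinners m S T).Nonempty :=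
  (Finset.powersetCard_nonempty.2 hm).image _

theorem subset_of_mem_priorityWinners {W : Finset ι} (hW : W ∈ priorityWinners m S T) :
    S ⊆ W ∧ W ⊆ S ∪ T := by
  obtain ⟨U, hU, rfl⟩ := Finset.mem_image.1 hW
  exact ⟨Finset.subset_union_left,
    Finset.union_subset_union_right (Finset.mem_powersetCard.1 hU).1⟩

theorem mem_priorityWinners (hST : Disjoint S T) {W : Finset ι} :
    W ∈ priorityWinners m S T ↔ #W = #S + m ∧ S ⊆ W ∧ W ⊆ S ∪ T := by
  refine ⟨fun hW => ⟨?_, subset_of_mem_priorityWinners hW⟩, fun ⟨card_eq, hSW, hWST⟩ => ?_⟩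
  · obtain ⟨U, hU, rfl⟩ := Finset.mem_image.1 hW
    obtain ⟨hUT, rfl⟩ := Finset.mem_powersetCard.1 hU
    exact Finset.card_union_of_disjoint (hST.mono_right hUT)
  · refine Finset.mem_image.2 ⟨W \ S, Finset.mem_powersetCard.2 ⟨?_, ?_⟩,
      Finset.union_sdiff_of_subset hSW⟩
    · exact sdiff_le_iff.2 hWST
    · rw [Finset.card_sdiff_of_subset hSW, card_eq, Nat.add_sub_cancel_left]

theorem injOn_union_left (hST : Disjoint S T) :
    Set.InjOn (S ∪ ·) (T.powersetCard m : Set (Finset ι)) := by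
  refine Set.LeftInvOn.injOn (f₁' := (· \ S)) fun U hU => ?_
  exact Finset.union_sdiff_cancel_left (hST.mono_right (Finset.mem_powersetCard.1 hU).1)

end PriorityWinners

section WinProbPriorityWinners

variable {n m : ℕ} {S T : Finset (Fin n)} {i : Fin n}

theorem winProb_priorityWinners_of_mem_left (hm : m ≤ #T) (hi : i ∈ S) :
    winProb (priorityWinners m S T) i = 1 :=
  winProb_eq_one (priorityWinners_nonempty hm) fun _ hW => (subset_of_mem_priorityWinners hW).1 hi

theorem winProb_priorityWinners_of_mem_right (hST : Disjoint S T) (hm : m ≤ #T) (hi : i ∈ T) :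
    winProb (priorityWinners m S T) i = (m : ℝ) / #T := by
  have hiS : i ∉ S := Finset.disjoint_right.1 hST hi
  have hinj := injOn_union_left (m := m) hST
  rw [← winProb_powersetCard hm hi, winProb, winProb, priorityWinners, Finset.filter_image,
    Finset.card_image_of_injOn hinj,
    Finset.card_image_of_injOn (hinj.mono (Finset.coe_subset.2 (Finset.filter_subset _ _)))]
  simp only [Finset.mem_union, hiS, false_or]

theorem winProb_priorityWinners_of_notMem (hi : i ∉ S ∪ T) :
    winProb (priorityWinners m S T) i = 0 :=
  winProb_eq_zero fun _ hW h => hi ((subset_of_mem_priorityWinners hW).2 h)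

end WinProbPriorityWinners

/-! ### Rationing -/

/-- The probability of obtaining one of `m` units that are allotted at random among `a` agents,
with the convention `rate 0 0 = 0`. -/
noncomputable def rate (m a : ℕ) : ℝ := (m : ℝ) / max (m : ℝ) a

section Rate

variable {m a : ℕ}

theorem rate_nonneg (m a : ℕ) : 0 ≤ rate m a := by
  unfold rate
  positivity

theorem rate_pos (hm : 0 < m) (a : ℕ) : 0 < rate m a := by
  unfold rate
  positivity

theorem rate_zero_left (a : ℕ) : rate 0 a = 0 := by
  rw [rate, Nat.cast_zero, zero_div]

theorem rate_of_ge (hm : 0 < m) (h : a ≤ m) : rate m a = 1 := by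
  rw [rate, max_eq_left (by exact_mod_cast h), div_self (by positivity)]

theorem rate_of_le (h : m ≤ a) : rate m a = (m : ℝ) / a := by
  rw [rate, max_eq_right (by exact_mod_cast h)]

theorem rate_le_rate {m' a' : ℕ} (b : ℕ) (hm : m ≤ m' - b) (ha : a' ≤ a + b) :
    rate m a ≤ rate m' a' := by
  rcases Nat.eq_zero_or_pos m with rfl | hm0
  · exact (rate_zero_left a).trans_le (rate_nonneg _ _)
  have hm' : (m + b : ℝ) ≤ m' := by exact_mod_cast (by omega : m + b ≤ m')
  have ha' : (a' : ℝ) ≤ a + b := by exact_mod_cast ha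
  have hm0' : 0 < m' := by omega
  unfold rate
  rw [div_le_div_iff₀ (by positivity) (by positivity), mul_max_of_nonneg _ _ (by positivity)]
  refine max_le ?_ ?_
  · rw [mul_comm (m : ℝ)]
    gcongr
    exact le_max_left _ _
  · calc (m : ℝ) * a' ≤ m * (a + b) := by gcongr
      _ = m * a + b * m := by ring
      _ ≤ m * max (m : ℝ) a + b * max (m : ℝ) a := by
          gcongr
          exacts [le_max_right _ _, le_max_left _ _]
      _ = (m + b) * max (m : ℝ) a := by ring
      _ ≤ m' * max (m : ℝ) a := by gcongr

theorem rate_mul_sum_of_card_le {ι : Type*} {A : Finset ι} (h : #A ≤ m) (f : ι → ℝ) :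
    rate m #A * ∑ i ∈ A, f i = ∑ i ∈ A, f i := by
  rcases A.eq_empty_or_nonempty with rfl | hA
  · simp
  · rw [rate_of_ge (hA.card_pos.trans_le h) h, one_mul]

end Rate

/-! ### The residual surplus of a two-price lottery -/

/-- The residual surplus of the two-price lottery with priority agents `S` and second-class agents
`T`, in a form that covers its three cases at once: an agent of `S` pays `p`, but gets the rebate
`p - q` with the probability of winning as an additional member of `T`. -/
noncomputable def splitSurplus {ι : Type*} (k : ℕ) (S T : Finset ι) (p q : ℝ) (v : ι → ℝ) : ℝ :=
  rate k #S * ∑ i ∈ S, (v i - p) + #S * rate (k + 1 - #S) (#T + 1) * (p - q) +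
    rate (k - #S) #T * ∑ i ∈ T, (v i - q)

section SplitSurplus

variable {ι : Type*} {k : ℕ} {S T A : Finset ι} {p q : ℝ} {v : ι → ℝ}

theorem splitSurplus_of_lt (h : k < #S) (T : Finset ι) (p q : ℝ) (v : ι → ℝ) :
    splitSurplus k S T p q v = rate k #S * ∑ i ∈ S, (v i - p) := by
  rw [splitSurplus, Nat.sub_eq_zero_of_le h, Nat.sub_eq_zero_of_le h.le, rate_zero_left,
    rate_zero_left]
  ring

theorem splitSurplus_of_add_le [DecidableEq ι] (hST : Disjoint S T) (h : #S + #T ≤ k) (p q : ℝ)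
    (v : ι → ℝ) : splitSurplus k S T p q v = ∑ i ∈ S ∪ T, (v i - q) := by
  rw [splitSurplus, rate_mul_sum_of_card_le (by omega), rate_mul_sum_of_card_le (by omega),
    rate_of_ge (by omega) (by omega), Finset.sum_union hST]
  simp only [Finset.sum_sub_distrib, Finset.sum_const, nsmul_eq_mul]
  ring

theorem splitSurplus_of_le_of_lt (hS : #S ≤ k) (hT : k < #S + #T) (p q : ℝ) (v : ι → ℝ) :
    splitSurplus k S T p q v =
      ∑ i ∈ S, (v i - (((k : ℝ) - #S + 1) / (#T + 1) * q + ((#S : ℝ) + #T - k) / (#T + 1) * p)) +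
        ∑ i ∈ T, ((k - #S : ℕ) : ℝ) / #T * (v i - q) := by
  have cast_units : ((k + 1 - #S : ℕ) : ℝ) = k - #S + 1 := by
    rw [Nat.cast_sub (by omega)]
    push_cast
    ring
  rw [splitSurplus, rate_mul_sum_of_card_le hS, rate_of_le (show k - #S ≤ #T by omega),
    rate_of_le (show k + 1 - #S ≤ #T + 1 by omega), cast_units, Finset.mul_sum]
  simp only [Finset.sum_sub_distrib, Finset.sum_const, nsmul_eq_mul, Nat.cast_add, Nat.cast_one]
  field_simp
  ring

theorem splitSurplus_nonneg (hqp : q ≤ p) (hS : ∀ i ∈ S, p ≤ v i) (hT : ∀ i ∈ T, q ≤ v i) :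
    0 ≤ splitSurplus k S T p q v := by
  have hS' : 0 ≤ ∑ i ∈ S, (v i - p) := Finset.sum_nonneg fun i hi => sub_nonneg.2 (hS i hi)
  have hT' : 0 ≤ ∑ i ∈ T, (v i - q) := Finset.sum_nonneg fun i hi => sub_nonneg.2 (hT i hi)
  have : 0 ≤ p - q := sub_nonneg.2 hqp
  have hrate := rate_nonneg
  unfold splitSurplus
  positivity [hrate k #S, hrate (k + 1 - #S) (#T + 1), hrate (k - #S) #T]

theorem splitSurplus_union_left_le [DecidableEq ι] (hSA : Disjoint S A) (hTA : Disjoint T A)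
    (hqp : q ≤ p) (hS : ∀ i ∈ S, p ≤ v i) (hT : ∀ i ∈ T, q ≤ v i) (hA : ∀ i ∈ A, v i = p) :
    splitSurplus k (S ∪ A) T p q v ≤ splitSurplus k S (T ∪ A) p q v := by
  rcases A.eq_empty_or_nonempty with rfl | hne
  · simp only [Finset.union_empty, le_refl]
  have hA0 : 0 < #A := hne.card_pos
  have hS' : 0 ≤ ∑ i ∈ S, (v i - p) := Finset.sum_nonneg fun i hi => sub_nonneg.2 (hS i hi)
  have hT' : 0 ≤ ∑ i ∈ T, (v i - q) := Finset.sum_nonneg fun i hi => sub_nonneg.2 (hT i hi)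
  have : 0 ≤ p - q := sub_nonneg.2 hqp
  have sum_left : ∑ i ∈ S ∪ A, (v i - p) = ∑ i ∈ S, (v i - p) := by
    rw [Finset.sum_union hSA, Finset.sum_eq_zero (s := A), add_zero]
    exact fun i hi => sub_eq_zero.2 (hA i hi)
  have sum_right : ∑ i ∈ T ∪ A, (v i - q) = ∑ i ∈ T, (v i - q) + #A * (p - q) := by
    rw [Finset.sum_union hTA, ← nsmul_eq_mul, ← Finset.sum_const]
    exact congrArg _ (Finset.sum_congr rfl fun i hi => by rw [hA i hi])
  unfold splitSurplus
  rw [Finset.card_union_of_disjoint hSA, Finset.card_union_of_disjoint hTA, sum_left, sum_right]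
  calc rate k (#S + #A) * ∑ i ∈ S, (v i - p)
        + (#S + #A : ℕ) * rate (k + 1 - (#S + #A)) (#T + 1) * (p - q)
        + rate (k - (#S + #A)) #T * ∑ i ∈ T, (v i - q)
      = rate k (#S + #A) * ∑ i ∈ S, (v i - p)
        + #S * rate (k + 1 - (#S + #A)) (#T + 1) * (p - q)
        + (rate (k - (#S + #A)) #T * ∑ i ∈ T, (v i - q)
          + rate (k + 1 - (#S + #A)) (#T + 1) * (#A * (p - q))) := by push_cast; ring
    _ ≤ rate k #S * ∑ i ∈ S, (v i - p)
        + #S * rate (k + 1 - #S) (#T + #A + 1) * (p - q)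
        + (rate (k - #S) (#T + #A) * ∑ i ∈ T, (v i - q)
          + rate (k - #S) (#T + #A) * (#A * (p - q))) := by
      gcongr
      · exact rate_le_rate 0 le_rfl (by omega)
      · exact rate_le_rate #A (by omega) (by omega)
      · exact rate_le_rate #A (by omega) (by omega)
      · exact rate_le_rate (#A - 1) (by omega) (by omega)
    _ = _ := by ring

theorem splitSurplus_union_right_le [DecidableEq ι] (hTA : Disjoint T A) (hqp : q ≤ p)
    (hT : ∀ i ∈ T, q ≤ v i) (hA : ∀ i ∈ A, v i = q) :
    splitSurplus k S (T ∪ A) p q v ≤ splitSurplus k S T p q v := by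
  have hT' : 0 ≤ ∑ i ∈ T, (v i - q) := Finset.sum_nonneg fun i hi => sub_nonneg.2 (hT i hi)
  have : 0 ≤ p - q := sub_nonneg.2 hqp
  have sum_right : ∑ i ∈ T ∪ A, (v i - q) = ∑ i ∈ T, (v i - q) := by
    rw [Finset.sum_union hTA, Finset.sum_eq_zero (s := A), add_zero]
    exact fun i hi => sub_eq_zero.2 (hA i hi)
  unfold splitSurplus
  rw [sum_right, Finset.card_union_of_disjoint hTA]
  gcongr <;> exact rate_le_rate 0 le_rfl (by omega)

end SplitSurplus

section TwoPriceOn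

variable {n k : ℕ} {S T : Finset (Fin n)} {p q : ℝ} {v : Fin n → ℝ}

theorem lotteryOn_surplus (k : ℕ) (A : Finset (Fin n)) (p : ℝ) (v : Fin n → ℝ) :
    (lotteryOn k A p).surplus v = rate k #A * ∑ i ∈ A, (v i - p) := by
  have winProb_of_mem : ∀ i ∈ A, winProb (lotteryOn k A p).winners i = rate k #A := by
    intro i hi
    have hA : 0 < #A := Finset.card_pos.2 ⟨i, hi⟩
    rw [lotteryOn, winProb_powersetCard (min_le_right _ _) hi]
    rcases le_total k #A with h | h
    · rw [min_eq_left h, rate_of_le h]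
    · rw [min_eq_right h, rate_of_ge (hA.trans_le h) h, div_self (by positivity)]
  rw [Outcome.surplus_eq_sum_winProb, Finset.mul_sum, ← Finset.sum_subset (Finset.subset_univ A)]
  · exact Finset.sum_congr rfl fun i hi => by rw [winProb_of_mem i hi, lotteryOn]
  · intro i _ hi
    rw [winProb_eq_zero, zero_mul]
    exact fun W hW h => hi ((Finset.mem_powersetCard.1 hW).1 h)

theorem twoPriceOn_of_le_of_lt (hS : #S ≤ k) (hT : k < #S + #T) (p q : ℝ) :
    twoPriceOn k S T p q =
      { winners := priorityWinners (k - #S) S T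
        price := fun i =>
          if i ∈ S then ((k : ℝ) - #S + 1) / (#T + 1) * q + ((#S : ℝ) + #T - k) / (#T + 1) * p
          else q } := by
  rw [twoPriceOn, if_neg hS.not_gt, if_neg hT.not_ge]
  simp only [lotteryOn, priorityWinners, min_eq_left (show k - #S ≤ #T by omega)]

theorem twoPriceOn_surplus (k : ℕ) (hST : Disjoint S T) (p q : ℝ) (v : Fin n → ℝ) :
    (twoPriceOn k S T p q).surplus v = splitSurplus k S T p q v := by
  rcases lt_or_ge k #S with hS | hS
  · rw [splitSurplus_of_lt hS, twoPriceOn, if_pos hS, lotteryOn_surplus]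
  rcases le_or_gt (#S + #T) k with hT | hT
  · rw [splitSurplus_of_add_le hST hT, twoPriceOn, if_neg hS.not_gt, if_pos hT, Outcome.surplus,
      Finset.sum_singleton, Finset.card_singleton, Nat.cast_one, div_one]
  have hm : k - #S ≤ #T := by omega
  rw [splitSurplus_of_le_of_lt hS hT, twoPriceOn_of_le_of_lt hS hT, Outcome.surplus_eq_sum_winProb,
    ← Finset.sum_subset (Finset.subset_univ (S ∪ T)), Finset.sum_union hST]
  · congr 1 <;> refine Finset.sum_congr rfl fun i hi => ?_
    · simp only [winProb_priorityWinners_of_mem_left hm hi, if_pos hi, one_mul]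
    · simp only [winProb_priorityWinners_of_mem_right hST hm hi,
        if_neg (Finset.disjoint_right.1 hST hi)]
  · exact fun i _ hi => by rw [winProb_priorityWinners_of_notMem hi, zero_mul]

theorem pqLottery_surplus (k : ℕ) (p q : ℝ) (v : Fin n → ℝ) :
    (pqLottery k p q v).surplus v =
      splitSurplus k ({i | p < v i} : Finset (Fin n)) {i | q < v i ∧ v i ≤ p} p q v :=
  twoPriceOn_surplus k (Finset.disjoint_filter.2 fun _ _ h h' => h'.2.not_gt h) p q v

theorem IsSplit.splitSurplus_nonneg (k : ℕ) (h : IsSplit v p q S T) (hqp : q ≤ p) :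
    0 ≤ splitSurplus k S T p q v :=
  MoneyBurning.splitSurplus_nonneg hqp h.ge_p_of_mem
    fun i hi => h.ge_q_of_mem i (Finset.mem_union_right _ hi)

theorem IsSplit.splitSurplus_le (k : ℕ) (h : IsSplit v p q S T) (hqp : q ≤ p) :
    splitSurplus k S T p q v ≤ (pqLottery k p q v).surplus v := by
  set S₀ : Finset (Fin n) := {i | p < v i} with hS₀
  set T₀ : Finset (Fin n) := {i | q < v i ∧ v i ≤ p} with hT₀
  set A : Finset (Fin n) := {i ∈ S | v i = p} with hA
  set A' : Finset (Fin n) := {i ∈ T ∪ A | v i = q} with hA'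
  have hS : S = S₀ ∪ A := by
    ext i
    have := h.mem_of_gt_p i
    have := h.ge_p_of_mem i
    simp only [hS₀, hA, Finset.mem_union, Finset.mem_filter]
    grind
  have hT : T ∪ A = T₀ ∪ A' := by
    ext i
    have := h.mem_of_gt_p i
    have := h.ge_p_of_mem i
    have := h.mem_of_gt_q i
    have := h.ge_q_of_mem i
    have : i ∈ S → i ∉ T := fun hi => Finset.disjoint_left.1 h.disjoint hi
    simp only [hT₀, hA', hA, Finset.mem_union, Finset.mem_filter]
    grind
  have hS₀A : Disjoint S₀ A := Finset.disjoint_left.2 fun i hi hi' =>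
    (Finset.mem_filter.1 hi).2.ne' (Finset.mem_filter.1 hi').2
  have hT₀A' : Disjoint T₀ A' := Finset.disjoint_left.2 fun i hi hi' =>
    (Finset.mem_filter.1 hi).2.1.ne' (Finset.mem_filter.1 hi').2
  calc splitSurplus k S T p q v = splitSurplus k (S₀ ∪ A) T p q v := by rw [← hS]
    _ ≤ splitSurplus k S₀ (T ∪ A) p q v :=
        splitSurplus_union_left_le hS₀A (h.disjoint.mono_left (Finset.filter_subset _ _)).symm
          hqp (fun i hi => (Finset.mem_filter.1 hi).2.le)
          (fun i hi => h.ge_q_of_mem i (Finset.mem_union_right _ hi))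
          fun i hi => (Finset.mem_filter.1 hi).2
    _ = splitSurplus k S₀ (T₀ ∪ A') p q v := by rw [hT]
    _ ≤ splitSurplus k S₀ T₀ p q v :=
        splitSurplus_union_right_le hT₀A' hqp (fun i hi => (Finset.mem_filter.1 hi).2.1.le)
          fun i hi => (Finset.mem_filter.1 hi).2
    _ = (pqLottery k p q v).surplus v := (pqLottery_surplus k p q v).symm

end TwoPriceOn

/-! ### The surplus as a function of the two prices -/

section Semicontinuity

theorem Icc_subset_image_of_upperSemicontinuousOn {α β : Type*} [ConditionallyCompleteLinearOrder α]
    [DenselyOrdered α] [TopologicalSpace α] [OrderTopology α] [LinearOrder β] [TopologicalSpace β]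
    [OrderTopology β] {f : α → β} {a b : α} (hab : a ≤ b)
    (hf : UpperSemicontinuousOn f (Set.Icc a b))
    (hright : ∀ c ∈ Set.Ico a b, ContinuousWithinAt f (Set.Ici c) c) :
    Set.Icc (f b) (f a) ⊆ f '' Set.Icc a b := by
  intro y hy
  obtain ⟨c, ⟨hc, hyc⟩, hmax⟩ := (hf.isCompact_inter_preimage_Ici isCompact_Icc y).exists_isGreatest
    ⟨a, Set.left_mem_Icc.2 hab, hy.2⟩
  refine ⟨c, hc, le_antisymm (not_lt.1 fun hlt => ?_) hyc⟩
  have hcb : c < b := hc.2.lt_of_ne fun h => (hy.1.trans_lt (h ▸ hlt)).false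
  have above : ∀ᶠ τ in 𝓝[>] c, y < f τ :=
    ((hright c ⟨hc.1, hcb⟩).mono Set.Ioi_subset_Ici_self).eventually_const_lt hlt
  have := nhdsGT_neBot_of_exists_gt ⟨b, hcb⟩
  obtain ⟨τ, hyτ, hτ⟩ := (above.and (Ioo_mem_nhdsGT hcb)).exists
  exact (hmax ⟨⟨hc.1.trans hτ.1.le, hτ.2.le⟩, hyτ.le⟩).not_gt hτ.1

theorem eventually_nhdsGE_lt_iff {ι : Type*} [Finite ι] (v : ι → ℝ) (c : ℝ) :
    ∀ᶠ τ in 𝓝[≥] c, ∀ i, τ < v i ↔ c < v i := by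
  refine eventually_all.2 fun i => ?_
  rcases lt_or_ge c (v i) with h | h
  · filter_upwards [mem_nhdsWithin_of_mem_nhds (Iio_mem_nhds h)] with τ hτ
    exact iff_of_true hτ h
  · filter_upwards [self_mem_nhdsWithin] with τ hτ
    exact iff_of_false (h.trans hτ).not_gt h.not_gt

theorem continuous_splitSurplus {ι : Type*} (k : ℕ) (S T : Finset ι) (v : ι → ℝ) :
    Continuous fun x : ℝ × ℝ => splitSurplus k S T x.1 x.2 v := by
  unfold splitSurplus
  fun_prop

variable {n : ℕ} {v : Fin n → ℝ} {p q : ℝ}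

theorem continuousWithinAt_pqLottery_surplus (k : ℕ) (p q : ℝ) (v : Fin n → ℝ) :
    ContinuousWithinAt (fun x : ℝ × ℝ => (pqLottery k x.1 x.2 v).surplus v) (Set.Ici (p, q))
      (p, q) := by
  have hp : Tendsto Prod.fst (𝓝[≥] (p, q)) (𝓝[≥] p) :=
    continuous_fst.continuousWithinAt.tendsto_nhdsWithin fun _ hx => hx.1
  have hq : Tendsto Prod.snd (𝓝[≥] (p, q)) (𝓝[≥] q) :=
    continuous_snd.continuousWithinAt.tendsto_nhdsWithin fun _ hx => hx.2
  refine ((continuous_splitSurplus k ({i | p < v i} : Finset (Fin n)) {i | q < v i ∧ v i ≤ p}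
    v).continuousWithinAt).congr_of_eventuallyEq ?_ (pqLottery_surplus k p q v)
  filter_upwards [hp.eventually (eventually_nhdsGE_lt_iff v p),
    hq.eventually (eventually_nhdsGE_lt_iff v q)] with x hxp hxq
  simp only [pqLottery_surplus, ← not_lt, hxp, hxq]

theorem eventually_isSplit (v : Fin n → ℝ) (hqp : q ≤ p) :
    ∀ᶠ x : ℝ × ℝ in 𝓝 (p, q), IsSplit v p q {i | x.1 < v i} {i | x.2 < v i ∧ v i ≤ x.1} := by
  have sameSide : ∀ {g : ℝ × ℝ → ℝ}, Continuous g → ∀ᶠ x in 𝓝 (p, q),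
      ∀ i, (g (p, q) < v i → g x < v i) ∧ (v i < g (p, q) → v i < g x) := by
    intro g hg
    refine eventually_all.2 fun i => ?_
    rcases lt_trichotomy (v i) (g (p, q)) with h | h | h
    · exact (hg.continuousAt.eventually_const_lt h).mono fun x hx => ⟨h.not_gt.elim, fun _ => hx⟩
    · exact .of_forall fun x => ⟨h.not_gt.elim, h.not_lt.elim⟩
    · exact (hg.continuousAt.eventually_lt_const h).mono fun x hx => ⟨fun _ => hx, h.not_gt.elim⟩
  filter_upwards [sameSide continuous_fst, sameSide continuous_snd] with x hp hq
  have ge_p : ∀ i, x.1 < v i → p ≤ v i := fun i hi => not_lt.1 fun h => ((hp i).2 h).not_gt hi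
  have ge_q : ∀ i, x.2 < v i → q ≤ v i := fun i hi => not_lt.1 fun h => ((hq i).2 h).not_gt hi
  refine ⟨Finset.disjoint_filter.2 fun _ _ h h' => h'.2.not_gt h, fun i hi => ?_, fun i hi => ?_,
    fun i hi => ?_, fun i hi => ?_, fun i j hij => ?_⟩ <;>
    simp only [Finset.mem_union, Finset.mem_filter_univ] at *
  · exact (hp i).1 hi
  · exact ge_p i hi
  · exact (lt_or_ge x.1 (v i)).imp_right fun h => ⟨(hq i).1 hi, h⟩
  · exact hi.elim (fun h => hqp.trans (ge_p i h)) fun h => ge_q i h.1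
  · simp only [hij, iff_self, and_self]

/-- Whichever way the agents at the thresholds are classified by prices near `(p, q)`, a seller
using this classification with the prices `p` and `q` does not beat the `(p, q)`-lottery. -/
theorem upperSemicontinuousAt_pqLottery_surplus (k : ℕ) (v : Fin n → ℝ) (hqp : q ≤ p) :
    UpperSemicontinuousAt (fun x : ℝ × ℝ => (pqLottery k x.1 x.2 v).surplus v) (p, q) := by
  intro y hy
  have near : ∀ S T : Finset (Fin n), ∀ᶠ x : ℝ × ℝ in 𝓝 (p, q), splitSurplus k S T p q v ≤
      (pqLottery k p q v).surplus v → splitSurplus k S T x.1 x.2 v < y := by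
    intro S T
    rcases lt_or_ge (splitSurplus k S T p q v) y with h | h
    · exact (((continuous_splitSurplus k S T v).tendsto (p, q)).eventually_lt_const h).mono
        fun x hx _ => hx
    · exact .of_forall fun x hle => absurd (h.trans hle) hy.not_ge
  filter_upwards [eventually_isSplit v hqp, eventually_all.2 fun S => eventually_all.2 (near S)]
    with x hsplit hx
  rw [pqLottery_surplus]
  exact hx _ _ (hsplit.splitSurplus_le k hqp)

theorem pqLottery_self_surplus (k : ℕ) (p : ℝ) (v : Fin n → ℝ) :
    (pqLottery k p p v).surplus v = rate k #{i | p < v i} * ∑ i with p < v i, (v i - p) := by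
  rw [pqLottery_surplus, splitSurplus,
    Finset.filter_false_of_mem (p := fun i => p < v i ∧ v i ≤ p) fun i _ h => h.2.not_gt h.1,
    Finset.sum_empty, sub_self, mul_zero, mul_zero, add_zero, add_zero]

theorem pqLottery_surplus_of_forall_le (k : ℕ) (q : ℝ) (h : ∀ i, v i ≤ p) :
    (pqLottery k p q v).surplus v = (pqLottery k q q v).surplus v := by
  rw [pqLottery_self_surplus, pqLottery_surplus, splitSurplus,
    Finset.filter_false_of_mem (p := fun i => p < v i) fun i _ => (h i).not_gt]
  simp only [h, and_true, Finset.sum_empty, Finset.card_empty, mul_zero, Nat.cast_zero, zero_mul,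
    zero_add, Nat.sub_zero]

theorem pqLottery_self_surplus_of_forall_le (k : ℕ) (h : ∀ i, v i ≤ p) :
    (pqLottery k p p v).surplus v = 0 := by
  rw [pqLottery_self_surplus, Finset.filter_false_of_mem fun i _ => (h i).not_gt, Finset.sum_empty,
    mul_zero]

theorem exists_forall_pqLottery_surplus_le (k : ℕ) (v : Fin n → ℝ) :
    ∃ p q : ℝ, 0 ≤ q ∧ q ≤ p ∧ ∀ p' q' : ℝ, 0 ≤ q' → q' ≤ p' →
      (pqLottery k p' q' v).surplus v ≤ (pqLottery k p q v).surplus v := by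
  obtain ⟨B, hB0, hB⟩ : ∃ B, 0 ≤ B ∧ ∀ i, v i ≤ B := by
    obtain ⟨B, hB⟩ := (Set.finite_range v).bddAbove
    exact ⟨max B 0, le_max_right _ _, fun i => (hB ⟨i, rfl⟩).trans (le_max_left _ _)⟩
  have hcompact : IsCompact (Set.Icc (0 : ℝ × ℝ) (B, B) ∩ {x | x.2 ≤ x.1}) :=
    isCompact_Icc.inter_right (isClosed_le continuous_snd continuous_fst)
  have hne : (Set.Icc (0 : ℝ × ℝ) (B, B) ∩ {x | x.2 ≤ x.1}).Nonempty :=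
    ⟨0, ⟨le_rfl, hB0, hB0⟩, le_refl (0 : ℝ)⟩
  obtain ⟨⟨p, q⟩, ⟨hpq, hqp⟩, hmax⟩ := UpperSemicontinuousOn.exists_isMaxOn hne hcompact fun x hx =>
    (upperSemicontinuousAt_pqLottery_surplus k v hx.2).upperSemicontinuousWithinAt _
  have bounded : ∀ p' q', 0 ≤ q' → q' ≤ p' → p' ≤ B →
      (pqLottery k p' q' v).surplus v ≤ (pqLottery k p q v).surplus v := fun p' q' hq' hqp' hp' =>
    hmax (a := (p', q')) ⟨⟨⟨hq'.trans hqp', hq'⟩, hp', hqp'.trans hp'⟩, hqp'⟩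
  refine ⟨p, q, hpq.1.2, hqp, fun p' q' hq' hqp' => ?_⟩
  rcases le_total p' B with hp' | hp'
  · exact bounded p' q' hq' hqp' hp'
  rw [pqLottery_surplus_of_forall_le k q' fun i => (hB i).trans hp']
  rcases le_total q' B with hqB | hqB
  · exact bounded q' q' hq' le_rfl hqB
  · rw [pqLottery_self_surplus_of_forall_le k fun i => (hB i).trans hqB,
      ← pqLottery_self_surplus_of_forall_le k hB]
    exact bounded B B hB0 le_rfl le_rfl

theorem exists_pqLottery_surplus_eq (k : ℕ) (hqp : q ≤ p) {y : ℝ} (hy : 0 ≤ y)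
    (hy' : y ≤ (pqLottery k p q v).surplus v) :
    ∃ p' q' : ℝ, q ≤ q' ∧ q' ≤ p' ∧ (pqLottery k p' q' v).surplus v = y := by
  obtain ⟨B, hpB, hB⟩ : ∃ B, p ≤ B ∧ ∀ i, v i ≤ B := by
    obtain ⟨B, hB⟩ := (Set.finite_range v).bddAbove
    exact ⟨max B p, le_max_right _ _, fun i => (hB ⟨i, rfl⟩).trans (le_max_left _ _)⟩
  let path : ℝ → ℝ × ℝ := fun τ => (max p τ, τ)
  have path_continuous : Continuous path := by fun_prop
  have path_mono : Monotone path := fun τ τ' h => ⟨max_le_max le_rfl h, h⟩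
  let f : ℝ → ℝ := fun τ => (pqLottery k (max p τ) τ v).surplus v
  have f_usc : ∀ τ, UpperSemicontinuousAt f τ := fun τ =>
    UpperSemicontinuousAt.comp (g := path)
      (upperSemicontinuousAt_pqLottery_surplus k v (le_max_right p τ))
      path_continuous.continuousAt
  have f_right : ∀ τ, ContinuousWithinAt f (Set.Ici τ) τ := fun τ =>
    ContinuousWithinAt.comp (f := path)
      (continuousWithinAt_pqLottery_surplus k (max p τ) τ v)
      path_continuous.continuousWithinAt fun _ hσ => path_mono hσ
  have f_left_end : f q = (pqLottery k p q v).surplus v := by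
    simp only [f, max_eq_left hqp]
  have f_right_end : f B = 0 := by
    simp only [f, max_eq_right hpB, pqLottery_self_surplus_of_forall_le k hB]
  obtain ⟨τ, hτ, rfl⟩ := Icc_subset_image_of_upperSemicontinuousOn (hqp.trans hpB)
    (fun τ _ => (f_usc τ).upperSemicontinuousWithinAt _) (fun τ _ => f_right τ)
    ⟨f_right_end.trans_le hy, hy'.trans_eq f_left_end.symm⟩
  exact ⟨max p τ, τ, hτ.1, le_max_right _ _, rfl⟩

end Semicontinuity

/-! ### Comparison with single-price lotteries -/

section SinglePrice

variable {n k : ℕ} {v : Fin n → ℝ} {p q : ℝ}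

theorem pqLottery_surplus_add_le (k : ℕ) (v : Fin n → ℝ) (hqp : q ≤ p) :
    (pqLottery k p q v).surplus v + rate k #{i | q < v i} * ∑ i with p < v i, (v i - p) ≤
      (pqLottery k p p v).surplus v + (pqLottery k q q v).surplus v := by
  rw [pqLottery_self_surplus, pqLottery_self_surplus, pqLottery_surplus, splitSurplus]
  set S : Finset (Fin n) := {i | p < v i}
  set T : Finset (Fin n) := {i | q < v i ∧ v i ≤ p}
  have hST : Disjoint S T := Finset.disjoint_filter.2 fun _ _ h h' => h'.2.not_gt h
  have union_eq : ({i | q < v i} : Finset (Fin n)) = S ∪ T := by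
    ext i
    simp only [S, T, Finset.mem_union, Finset.mem_filter_univ]
    grind
  have sum_S : ∑ i ∈ S, (v i - q) = ∑ i ∈ S, (v i - p) + #S * (p - q) := by
    simp only [Finset.sum_sub_distrib, Finset.sum_const, nsmul_eq_mul]
    ring
  have hT : 0 ≤ ∑ i ∈ T, (v i - q) :=
    Finset.sum_nonneg fun i hi => sub_nonneg.2 (Finset.mem_filter.1 hi).2.1.le
  have hpq : 0 ≤ p - q := sub_nonneg.2 hqp
  have rebate_le : #S * rate (k + 1 - #S) (#T + 1) ≤ #S * rate k (#S + #T) := by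
    rcases (#S).eq_zero_or_pos with h | h
    · simp only [h, Nat.cast_zero, zero_mul, le_refl]
    · gcongr
      exact rate_le_rate (#S - 1) (by omega) (by omega)
  rw [union_eq, Finset.card_union_of_disjoint hST, Finset.sum_union hST, sum_S]
  calc
    rate k #S * ∑ i ∈ S, (v i - p) + #S * rate (k + 1 - #S) (#T + 1) * (p - q)
        + rate (k - #S) #T * ∑ i ∈ T, (v i - q) + rate k (#S + #T) * ∑ i ∈ S, (v i - p)
    _ ≤ rate k #S * ∑ i ∈ S, (v i - p) + #S * rate k (#S + #T) * (p - q)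
        + rate k (#S + #T) * ∑ i ∈ T, (v i - q) + rate k (#S + #T) * ∑ i ∈ S, (v i - p) := by
      gcongr
      exact rate_le_rate #S le_rfl (by omega)
    _ = _ := by ring

theorem pqLottery_surplus_le_add (k : ℕ) (v : Fin n → ℝ) (hqp : q ≤ p) :
    (pqLottery k p q v).surplus v ≤
      (pqLottery k p p v).surplus v + (pqLottery k q q v).surplus v := by
  refine (le_add_of_nonneg_right ?_).trans (pqLottery_surplus_add_le k v hqp)
  exact mul_nonneg (rate_nonneg _ _)
    (Finset.sum_nonneg fun i hi => sub_nonneg.2 (Finset.mem_filter.1 hi).2.le)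

theorem pqLottery_surplus_lt_add (hqp : q ≤ p) (hpos : 0 < (pqLottery k p p v).surplus v) :
    (pqLottery k p q v).surplus v <
      (pqLottery k p p v).surplus v + (pqLottery k q q v).surplus v := by
  refine (lt_add_of_pos_right _ ?_).trans_le (pqLottery_surplus_add_le k v hqp)
  rw [pqLottery_self_surplus] at hpos
  have hk : 0 < k := Nat.pos_of_ne_zero fun h => by
    rw [h, rate_zero_left, zero_mul] at hpos
    exact hpos.false
  exact mul_pos (rate_pos hk _) (pos_of_mul_pos_right hpos (rate_nonneg _ _))

theorem pLottery_surplus_nonneg (k : ℕ) (p : ℝ) (v : Fin n → ℝ) :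
    0 ≤ (pLottery k p v).surplus v := by
  rw [pLottery, lotteryOn_surplus]
  exact mul_nonneg (rate_nonneg _ _)
    (Finset.sum_nonneg fun i hi => sub_nonneg.2 (Finset.mem_filter.1 hi).2)

theorem pLottery_surplus_of_forall_ne (k : ℕ) (h : ∀ i, v i ≠ p) :
    (pLottery k p v).surplus v = (pqLottery k p p v).surplus v := by
  have le_iff_lt : ∀ i, p ≤ v i ↔ p < v i := fun i => (h i).symm.le_iff_lt
  simp only [pLottery, lotteryOn_surplus, pqLottery_self_surplus, le_iff_lt]

theorem exists_lt_pLottery_surplus {y : ℝ} (hy : y < (pqLottery k p p v).surplus v) :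
    ∃ p' > p, y < (pLottery k p' v).surplus v := by
  have path_mono : Monotone fun τ : ℝ => (τ, τ) := fun _ _ h => ⟨h, h⟩
  have hright : ContinuousWithinAt (fun τ => (pqLottery k τ τ v).surplus v) (Set.Ici p) p :=
    ContinuousWithinAt.comp (f := fun τ : ℝ => (τ, τ))
      (continuousWithinAt_pqLottery_surplus k p p v)
      (continuous_id.prodMk continuous_id).continuousWithinAt fun _ hσ => path_mono hσ
  have hlt := (hright.eventually_const_lt hy).and (eventually_nhdsGE_lt_iff v p)
  obtain ⟨p', ⟨hyp', hiff⟩, hp'⟩ :=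
    ((hlt.filter_mono (nhdsWithin_mono p Set.Ioi_subset_Ici_self)).and self_mem_nhdsWithin).exists
  refine ⟨p', hp', ?_⟩
  rwa [pLottery_surplus_of_forall_ne k fun i hi => ((hiff i).2 (hp'.trans_eq hi.symm)).ne' hi]

theorem exists_pLottery_surplus_ge_half (k : ℕ) (v : Fin n → ℝ) (hqp : q ≤ p) :
    ∃ p' ≥ q, (pqLottery k p q v).surplus v / 2 ≤ (pLottery k p' v).surplus v := by
  rcases le_or_gt ((pqLottery k p q v).surplus v) 0 with hle | hpos
  · exact ⟨q, le_rfl, (div_nonpos_of_nonpos_of_nonneg hle two_pos.le).trans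
      (pLottery_surplus_nonneg k q v)⟩
  have half_lt : (pqLottery k p q v).surplus v / 2 < (pqLottery k p p v).surplus v ∨
      (pqLottery k p q v).surplus v / 2 < (pqLottery k q q v).surplus v := by
    rcases le_or_gt ((pqLottery k p p v).surplus v) 0 with hpp | hpp
    · exact Or.inr (by linarith [pqLottery_surplus_le_add k v hqp])
    · by_contra! hcon
      linarith [pqLottery_surplus_lt_add hqp hpp]
  rcases half_lt with h | h
  · obtain ⟨p', hp', hlt⟩ := exists_lt_pLottery_surplus h
    exact ⟨p', hqp.trans hp'.le, hlt.le⟩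
  · obtain ⟨p', hp', hlt⟩ := exists_lt_pLottery_surplus h
    exact ⟨p', hp'.le, hlt.le⟩

end SinglePrice

/-! ### One-sided derivatives of convex functions -/

section ConvexDeriv

variable {f : ℝ → ℝ} {a b x y : ℝ}

theorem differentiableWithinAt_Icc_left_of_convexOn (hf : ConvexOn ℝ (Set.Icc a b) f) (hab : a < b)
    (hbdd : BddBelow (slope f a '' Set.Ioo a b)) : DifferentiableWithinAt ℝ f (Set.Icc a b) a := by
  have slope_mono : MonotoneOn (slope f a) (Set.Ioo a b) :=
    (hf.monotoneOn_slope_gt (Set.left_mem_Icc.2 hab.le)).mono fun _ hy =>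
      ⟨Set.Ioo_subset_Icc_self hy, hy.1⟩
  have slope_tendsto := slope_mono.tendsto_nhdsWithin_Ioo_right (Set.nonempty_Ioo.2 hab) hbdd
  rw [← hasDerivWithinAt_iff_tendsto_slope' Set.self_notMem_Ioi,
    hasDerivWithinAt_Ioi_iff_Ici] at slope_tendsto
  exact (slope_tendsto.mono Set.Icc_subset_Ici_self).differentiableWithinAt

theorem differentiableWithinAt_Icc_right_of_convexOn (hf : ConvexOn ℝ (Set.Icc a b) f)
    (hab : a < b) (hbdd : BddAbove (slope f b '' Set.Ioo a b)) :
    DifferentiableWithinAt ℝ f (Set.Icc a b) b := by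
  have slope_mono : MonotoneOn (slope f b) (Set.Ioo a b) :=
    (hf.monotoneOn_slope_lt (Set.right_mem_Icc.2 hab.le)).mono fun _ hy =>
      ⟨Set.Ioo_subset_Icc_self hy, hy.2⟩
  have slope_tendsto := slope_mono.tendsto_nhdsWithin_Ioo_left (Set.nonempty_Ioo.2 hab) hbdd
  rw [← hasDerivWithinAt_iff_tendsto_slope' Set.self_notMem_Iio,
    hasDerivWithinAt_Iio_iff_Iic] at slope_tendsto
  exact (slope_tendsto.mono Set.Icc_subset_Iic_self).differentiableWithinAt

theorem derivWithin_Icc_left_le_slope (hf : ConvexOn ℝ (Set.Icc a b) f) (hx : a ≤ x) (hxy : x < y)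
    (hy : y ≤ b) (hfx : DifferentiableWithinAt ℝ f (Set.Icc x b) x) :
    derivWithin f (Set.Icc x b) x ≤ slope f x y :=
  (hf.subset (Set.Icc_subset_Icc_left hx) (convex_Icc x b)).derivWithin_le_slope
    ⟨le_rfl, hxy.le.trans hy⟩ ⟨hxy.le, hy⟩ hxy hfx

theorem slope_le_derivWithin_Icc_left (hf : ConvexOn ℝ (Set.Icc a b) f) (hx : a ≤ x) (hxy : x < y)
    (hy : y < b) : slope f x y ≤ derivWithin f (Set.Icc y b) y := by
  have y_mem : y ∈ interior (Set.Icc a b) := by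
    rw [interior_Icc]
    exact ⟨hx.trans_lt hxy, hy⟩
  calc slope f x y ≤ derivWithin f (Set.Iio y) y :=
        hf.slope_le_leftDeriv_of_mem_interior ⟨hx, (hxy.trans hy).le⟩ y_mem hxy
    _ ≤ derivWithin f (Set.Ioi y) y := hf.leftDeriv_le_rightDeriv_of_mem_interior y_mem
    _ = derivWithin f (Set.Ici y) y := derivWithin_Ioi_eq_Ici f y
    _ = derivWithin f (Set.Icc y b) y := by
      rw [← Set.Ici_inter_Iic, derivWithin_inter (Iic_mem_nhds hy)]

end ConvexDeriv

/-! ### Distribution functions and quantiles -/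

namespace Prior

variable (D : Prior)

theorem density_nonneg (z : ℝ) : 0 ≤ D.density z := by
  by_cases h : z ∈ D.support
  · exact (D.density_pos z h).le
  · exact (D.density_eq_zero z h).ge

theorem cdf_mono : Monotone D.cdf := fun _ _ h =>
  setIntegral_mono_set D.integrable_density.integrableOn
    (Eventually.of_forall D.density_nonneg) (Set.Iic_subset_Iic.2 h).eventuallyLE

theorem cdf_nonneg (z : ℝ) : 0 ≤ D.cdf z := integral_nonneg D.density_nonneg

theorem cdf_le_one (z : ℝ) : D.cdf z ≤ 1 := by
  rw [← D.integral_density]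
  exact setIntegral_le_integral D.integrable_density (Eventually.of_forall D.density_nonneg)

theorem cdf_sub_cdf (a b : ℝ) : D.cdf b - D.cdf a = ∫ t in a..b, D.density t :=
  intervalIntegral.integral_Iic_sub_Iic D.integrable_density.integrableOn
    D.integrable_density.integrableOn

theorem continuous_cdf : Continuous D.cdf := by
  have cdf_eq : D.cdf = fun z => (∫ t in (0 : ℝ)..z, D.density t) + D.cdf 0 :=
    funext fun z => by rw [← cdf_sub_cdf, sub_add_cancel]
  rw [cdf_eq]
  exact (intervalIntegral.continuous_primitive
    (fun _ _ => D.integrable_density.intervalIntegrable) 0).add continuous_const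

theorem cdf_lt_cdf {a b : ℝ} (hab : a < b) (h : Set.Ioo a b ⊆ D.support) :
    D.cdf a < D.cdf b := by
  rw [← sub_pos, cdf_sub_cdf]
  exact intervalIntegral.intervalIntegral_pos_of_pos_on D.integrable_density.intervalIntegrable
    (fun z hz => D.density_pos z (h hz)) hab

theorem cdf_eq_zero {z : ℝ} (h : ∀ w ∈ D.support, z < w) : D.cdf z = 0 :=
  setIntegral_eq_zero_of_forall_eq_zero fun t ht =>
    D.density_eq_zero t fun hs => (h t hs).not_ge ht

theorem tendsto_cdf_atTop : Tendsto D.cdf atTop (𝓝 1) := by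
  have h := (aecover_Iic (μ := volume) tendsto_id).integral_tendsto_of_countably_generated
    D.integrable_density
  rwa [D.integral_density] at h

theorem nonneg_of_cdf_pos {z : ℝ} (hz : 0 < D.cdf z) : 0 ≤ z := by
  by_contra! hneg
  exact hz.ne' (D.cdf_eq_zero fun w hw => hneg.trans_le (D.support_nonneg w hw))

theorem le_of_cdf_eq_one {z w : ℝ} (hz : D.cdf z = 1) (hw : w ∈ D.support) : w ≤ z := by
  by_contra! hlt
  obtain ⟨u, hu, huz⟩ : ∃ u ∈ D.support, u ≤ z := by
    by_contra! hcon
    exact one_ne_zero (hz.symm.trans (D.cdf_eq_zero hcon))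
  have := D.cdf_lt_cdf hlt fun t ht =>
    D.ordConnected_support.out hu hw ⟨huz.trans ht.1.le, ht.2.le⟩
  exact (hz.symm.trans_lt this).not_ge (D.cdf_le_one w)

theorem quantile_cdf {z : ℝ} (hz : z ∈ D.support) : D.quantile (D.cdf z) = z := by
  refine IsLeast.csInf_eq ⟨⟨hz, le_rfl⟩, fun w hw => ?_⟩
  by_contra! hlt
  exact absurd hw.2 (D.cdf_lt_cdf hlt fun t ht =>
    D.ordConnected_support.out hw.1 hz ⟨ht.1.le, ht.2.le⟩).not_ge

/-- The distribution `F` as a measure, for computing expectations by a change of variables. -/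
noncomputable def law : Measure ℝ := volume.withDensity fun z => ENNReal.ofReal (D.density z)

theorem law_Iic (z : ℝ) : D.law (Set.Iic z) = ENNReal.ofReal (D.cdf z) := by
  rw [law, withDensity_apply _ measurableSet_Iic, cdf,
    ofReal_integral_eq_lintegral_ofReal D.integrable_density.integrableOn
      (Eventually.of_forall D.density_nonneg)]

theorem law_univ : D.law Set.univ = 1 := by
  rw [law, withDensity_apply _ MeasurableSet.univ, Measure.restrict_univ,
    ← ofReal_integral_eq_lintegral_ofReal D.integrable_density
      (Eventually.of_forall D.density_nonneg), D.integral_density, ENNReal.ofReal_one]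

theorem exists_preimage_cdf_Iic_eq {r : ℝ} (hr : 0 ≤ r) (hr1 : r < 1) :
    ∃ m, D.cdf m = r ∧ D.cdf ⁻¹' Set.Iic r = Set.Iic m := by
  obtain ⟨b, hb⟩ := (D.tendsto_cdf_atTop.eventually_const_lt hr1).exists
  have low : D.cdf (-1) ≤ r :=
    (D.cdf_eq_zero fun w hw => neg_one_lt_zero.trans_le (D.support_nonneg w hw)).trans_le hr
  have hne : (D.cdf ⁻¹' {r}).Nonempty :=
    mem_range_of_exists_le_of_exists_ge D.continuous_cdf ⟨_, low⟩ ⟨b, hb.le⟩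
  have hbdd : BddAbove (D.cdf ⁻¹' {r}) :=
    ⟨b, fun z hz => (D.cdf_mono.reflect_lt (hz.trans_lt hb)).le⟩
  obtain ⟨hm, hmax⟩ := (isClosed_singleton.preimage D.continuous_cdf).isGreatest_csSup hne hbdd
  refine ⟨_, hm, Set.ext fun z => ⟨fun hz => ?_, fun hz => (D.cdf_mono hz).trans hm.le⟩⟩
  by_contra hlt
  exact hlt (hmax (le_antisymm hz (hm.ge.trans (D.cdf_mono (not_le.1 hlt).le))))

theorem law_preimage_cdf_Iic (r : ℝ) :
    D.law (D.cdf ⁻¹' Set.Iic r) = ENNReal.ofReal (min 1 r) := by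
  rcases lt_or_ge r 0 with hr | hr
  · have preimage_empty : D.cdf ⁻¹' Set.Iic r = ∅ := Set.eq_empty_of_forall_notMem
      fun z (hz : D.cdf z ≤ r) => hz.not_gt (hr.trans_le (D.cdf_nonneg z))
    rw [preimage_empty, measure_empty,
      ENNReal.ofReal_of_nonpos ((min_le_right _ _).trans hr.le)]
  rcases le_or_gt 1 r with hr1 | hr1
  · have preimage_univ : D.cdf ⁻¹' Set.Iic r = Set.univ :=
      Set.eq_univ_of_forall fun z => (D.cdf_le_one z).trans hr1
    rw [preimage_univ, law_univ, min_eq_left hr1, ENNReal.ofReal_one]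
  · obtain ⟨m, hm, hpre⟩ := D.exists_preimage_cdf_Iic_eq hr hr1
    rw [hpre, law_Iic, hm, min_eq_right hr1.le]

theorem map_cdf_law : D.law.map D.cdf = volume.restrict (Set.Ioc 0 1) := by
  have : IsFiniteMeasure D.law := ⟨D.law_univ.trans_lt ENNReal.one_lt_top⟩
  refine Measure.ext_of_Iic _ _ fun r => ?_
  rw [Measure.map_apply D.continuous_cdf.measurable measurableSet_Iic, law_preimage_cdf_Iic,
    Measure.restrict_apply measurableSet_Iic, Set.inter_comm, Set.Ioc_inter_Iic, Real.volume_Ioc,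
    sub_zero]

/-! ### The ironed virtual valuation -/

theorem virtualValue_nonneg (z : ℝ) : 0 ≤ D.virtualValue z :=
  div_nonneg (sub_nonneg.2 (D.cdf_le_one z)) (D.density_nonneg z)

theorem cumulative_nonneg {r : ℝ} (hr : 0 ≤ r) : 0 ≤ D.cumulative r :=
  intervalIntegral.integral_nonneg hr fun _ _ => D.virtualValue_nonneg _

theorem lintegral_virtualValue_le {C : ℝ} (hC : D.cdf C = 1) {r : ℝ} (hr : 0 ≤ r) :
    ∫⁻ x in Set.Ioc r 1, ENNReal.ofReal (D.virtualValue (D.quantile x)) ≤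
      ENNReal.ofReal (C * (1 - r)) := by
  have hC0 : 0 ≤ C := D.nonneg_of_cdf_pos (by rw [hC]; exact one_pos)
  set G : ℝ → ENNReal := (Set.Ioc r 1).indicator
    fun x => ENNReal.ofReal (D.virtualValue (D.quantile x)) with hG
  have density_mul_le : ∀ z, ENNReal.ofReal (D.density z) * G (D.cdf z) ≤
      (Set.Icc 0 C).indicator (fun _ => ENNReal.ofReal (1 - r)) z := by
    intro z
    by_cases hz : z ∈ D.support
    · rw [Set.indicator_of_mem (show z ∈ Set.Icc 0 C from
        ⟨D.support_nonneg z hz, D.le_of_cdf_eq_one hC hz⟩)]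
      by_cases hm : D.cdf z ∈ Set.Ioc r 1
      · rw [hG, Set.indicator_of_mem hm, D.quantile_cdf hz,
          ← ENNReal.ofReal_mul (D.density_nonneg z), virtualValue,
          mul_div_cancel₀ _ (D.density_pos z hz).ne']
        exact ENNReal.ofReal_le_ofReal (sub_le_sub_left hm.1.le 1)
      · rw [hG, Set.indicator_of_notMem hm, mul_zero]
        exact zero_le
    · rw [D.density_eq_zero z hz, ENNReal.ofReal_zero, zero_mul]
      exact zero_le
  calc ∫⁻ x in Set.Ioc r 1, ENNReal.ofReal (D.virtualValue (D.quantile x))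
      = ∫⁻ x in Set.Ioc 0 1, G x := by
        rw [hG, lintegral_indicator measurableSet_Ioc, Measure.restrict_restrict measurableSet_Ioc,
          Set.inter_eq_left.2 (Set.Ioc_subset_Ioc_left hr)]
    _ = ∫⁻ x, G x ∂(D.law.map D.cdf) := by rw [map_cdf_law]
    _ ≤ ∫⁻ z, G (D.cdf z) ∂D.law := lintegral_map_le _ _
    _ ≤ ∫⁻ z, ENNReal.ofReal (D.density z) * G (D.cdf z) :=
        lintegral_withDensity_le_lintegral_mul _ D.measurable_density.ennreal_ofReal _
    _ ≤ ∫⁻ z, (Set.Icc 0 C).indicator (fun _ => ENNReal.ofReal (1 - r)) z :=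
        lintegral_mono density_mul_le
    _ = ENNReal.ofReal (C * (1 - r)) := by
        rw [lintegral_indicator measurableSet_Icc, setLIntegral_const, Real.volume_Icc, sub_zero,
          mul_comm, ENNReal.ofReal_mul hC0]

theorem cumulative_one_sub_le {C : ℝ} (hC : D.cdf C = 1) {r : ℝ} (hr : r ∈ Set.Icc (0 : ℝ) 1) :
    D.cumulative 1 - D.cumulative r ≤ C * (1 - r) := by
  have hC0 : 0 ≤ C := D.nonneg_of_cdf_pos (by rw [hC]; exact one_pos)
  have hC1 : 0 ≤ C * (1 - r) := mul_nonneg hC0 (sub_nonneg.2 hr.2)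
  by_cases hvv : IntervalIntegrable (fun x => D.virtualValue (D.quantile x)) volume 0 1
  · have hvv_r := hvv.mono_set (Set.uIcc_subset_uIcc_left (Set.mem_uIcc_of_le hr.1 hr.2))
    have hvv_Ioc := hvv.1.mono_set (Set.Ioc_subset_Ioc_left hr.1)
    rw [cumulative, cumulative, intervalIntegral.integral_interval_sub_left hvv hvv_r,
      intervalIntegral.integral_of_le hr.2, integral_eq_lintegral_of_nonneg_ae
        (Eventually.of_forall fun _ => D.virtualValue_nonneg _) hvv_Ioc.aestronglyMeasurable]
    exact ENNReal.toReal_le_of_le_ofReal hC1 (D.lintegral_virtualValue_le hC hr.1)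
  · -- the junk value `0` of a divergent integral
    have cumulative_one : D.cumulative 1 = 0 := intervalIntegral.integral_undef hvv
    linarith [D.cumulative_nonneg hr.1]

theorem le_hull {φ : ℝ → ℝ} (hφ : ConvexOn ℝ (Set.Icc 0 1) φ)
    (h : ∀ r ∈ Set.Icc (0 : ℝ) 1, φ r ≤ D.cumulative r) {r : ℝ} (hr : r ∈ Set.Icc (0 : ℝ) 1) :
    φ r ≤ D.hull r :=
  le_csSup ⟨D.cumulative r, by rintro _ ⟨ψ, -, hψ, rfl⟩; exact hψ r hr⟩ ⟨φ, hφ, h, rfl⟩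

theorem hull_le {r y : ℝ} (h : ∀ φ : ℝ → ℝ, ConvexOn ℝ (Set.Icc 0 1) φ →
    (∀ r ∈ Set.Icc (0 : ℝ) 1, φ r ≤ D.cumulative r) → φ r ≤ y) : D.hull r ≤ y := by
  refine csSup_le ⟨0, fun _ => 0, convexOn_const _ (convex_Icc _ _),
    fun r hr => D.cumulative_nonneg hr.1, rfl⟩ ?_
  rintro _ ⟨φ, hφ, hφ_le, rfl⟩
  exact h φ hφ hφ_le

theorem hull_nonneg {r : ℝ} (hr : r ∈ Set.Icc (0 : ℝ) 1) : 0 ≤ D.hull r :=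
  D.le_hull (φ := fun _ => 0) (convexOn_const _ (convex_Icc _ _))
    (fun _ hr => D.cumulative_nonneg hr.1) hr

theorem hull_zero : D.hull 0 = 0 := by
  refine le_antisymm (D.hull_le fun φ _ h => ?_) (D.hull_nonneg unitInterval.zero_mem)
  exact (h 0 unitInterval.zero_mem).trans_eq intervalIntegral.integral_same

theorem convexOn_hull : ConvexOn ℝ (Set.Icc 0 1) D.hull := by
  refine ⟨convex_Icc _ _, fun x hx y hy a b ha hb hab => D.hull_le fun φ hφ hφ_le => ?_⟩
  refine (hφ.2 hx hy ha hb hab).trans ?_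
  gcongr
  · exact D.le_hull hφ hφ_le hx
  · exact D.le_hull hφ hφ_le hy

theorem monotoneOn_hull : MonotoneOn D.hull (Set.Icc 0 1) := by
  intro x hx y hy hxy
  rcases hx.1.eq_or_lt with rfl | hx0
  · exact D.hull_zero.trans_le (D.hull_nonneg hy)
  · exact D.convexOn_hull.le_right_of_left_le'' unitInterval.zero_mem hy hx0 hxy
      (D.hull_zero.trans_le (D.hull_nonneg hx))

theorem hull_one_sub_le {C : ℝ} (hC : D.cdf C = 1) {r : ℝ} (hr : r ∈ Set.Icc (0 : ℝ) 1) :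
    D.hull 1 - D.hull r ≤ C * (1 - r) := by
  have hull_one_le : D.hull 1 ≤ D.cumulative 1 :=
    D.hull_le fun φ _ h => h 1 unitInterval.one_mem
  have line_convex : ConvexOn ℝ (Set.Icc 0 1) fun x : ℝ => D.cumulative 1 - C * (1 - x) := by
    refine ⟨convex_Icc _ _, fun x _ y _ a b _ _ hab => le_of_eq ?_⟩
    obtain rfl : b = 1 - a := by linarith
    simp only [smul_eq_mul]
    ring
  have line_le_hull := D.le_hull line_convex
    (fun x hx => by linarith [D.cumulative_one_sub_le hC hx]) hr
  linarith

theorem hullSlope_nonneg {r : ℝ} (hr : 0 ≤ r) : 0 ≤ D.hullSlope r := by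
  rw [hullSlope]
  split_ifs
  · exact (D.monotoneOn_hull.mono (Set.Icc_subset_Icc_left hr)).derivWithin_nonneg
  · exact D.monotoneOn_hull.derivWithin_nonneg

theorem hullSlope_le_slope {r s : ℝ} (hr : 0 ≤ r) (hrs : r < s) (hs : s ≤ 1) :
    D.hullSlope r ≤ slope D.hull r s := by
  have hr1 : r < 1 := hrs.trans_le hs
  rw [hullSlope, if_pos hr1]
  refine derivWithin_Icc_left_le_slope D.convexOn_hull hr hrs hs
    (differentiableWithinAt_Icc_left_of_convexOn
      (D.convexOn_hull.subset (Set.Icc_subset_Icc_left hr) (convex_Icc r 1)) hr1 ⟨0, ?_⟩)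
  rintro _ ⟨y, hy, rfl⟩
  rw [slope_def_field]
  exact div_nonneg (sub_nonneg.2 (D.monotoneOn_hull ⟨hr, hr1.le⟩ ⟨hr.trans hy.1.le, hy.2.le⟩
    hy.1.le)) (sub_nonneg.2 hy.1.le)

theorem slope_le_hullSlope {r s : ℝ} (hr : 0 ≤ r) (hrs : r < s) (hs : s < 1) :
    slope D.hull r s ≤ D.hullSlope s := by
  rw [hullSlope, if_pos hs]
  exact slope_le_derivWithin_Icc_left D.convexOn_hull hr hrs hs

/-- For an unbounded support the left derivative of the hull at `1` may be infinite; hence the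
assumption that the distribution function reaches `1`. -/
theorem slope_le_hullSlope_one {C : ℝ} (hC : D.cdf C = 1) {r : ℝ} (hr : 0 ≤ r) (hr1 : r < 1) :
    slope D.hull r 1 ≤ D.hullSlope 1 := by
  rw [hullSlope, if_neg (lt_irrefl _)]
  refine D.convexOn_hull.slope_le_derivWithin ⟨hr, hr1.le⟩ unitInterval.one_mem hr1
    (differentiableWithinAt_Icc_right_of_convexOn D.convexOn_hull one_pos ⟨C, ?_⟩)
  rintro _ ⟨y, hy, rfl⟩
  rw [slope_comm, slope_def_field, div_le_iff₀ (sub_pos.2 hy.2)]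
  exact D.hull_one_sub_le hC (Set.Ioo_subset_Icc_self hy)

theorem ironedValue_nonneg (z : ℝ) : 0 ≤ D.ironedValue z :=
  D.hullSlope_nonneg (D.cdf_nonneg z)

theorem ironedValue_mono : Monotone D.ironedValue := by
  intro z w hzw
  rw [ironedValue, ironedValue]
  rcases (D.cdf_mono hzw).eq_or_lt with heq | hlt
  · rw [heq]
  refine (D.hullSlope_le_slope (D.cdf_nonneg z) hlt (D.cdf_le_one w)).trans ?_
  rcases (D.cdf_le_one w).lt_or_eq with hw | hw
  · exact D.slope_le_hullSlope (D.cdf_nonneg z) hlt hw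
  · rw [hw] at hlt ⊢
    exact D.slope_le_hullSlope_one hw (D.cdf_nonneg z) hlt

/-- The uniform distribution on `[0, 1]`, which shows that the supremum over all priors in the
benchmark is not over an empty family. -/
noncomputable def uniform : Prior where
  density := (Set.Icc 0 1).indicator 1
  support := Set.Icc 0 1
  isClosed_support := isClosed_Icc
  ordConnected_support := Set.ordConnected_Icc
  support_nonneg _ hz := hz.1
  measurable_density := measurable_one.indicator measurableSet_Icc
  density_pos z hz := by simp only [Set.indicator_of_mem hz, Pi.one_apply, one_pos]
  density_eq_zero _ hz := Set.indicator_of_notMem hz _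
  integrable_density :=
    (integrable_indicator_iff measurableSet_Icc).2 continuous_one.integrableOn_Icc
  integral_density := by
    rw [integral_indicator measurableSet_Icc]
    simp
  integrable_mean := by
    have mean_eq : (fun z => z * (Set.Icc (0 : ℝ) 1).indicator 1 z) =
        (Set.Icc 0 1).indicator fun z => z * (1 : ℝ → ℝ) z :=
      funext fun _ => (Set.indicator_mul_right _ (fun z => z) 1).symm
    rw [mean_eq, integrable_indicator_iff measurableSet_Icc]
    exact (continuous_id.mul continuous_one).integrableOn_Icc

instance : Nonempty Prior := ⟨uniform⟩

end Prior

/-! ### Cutoff levels and the winners of the optimal mechanism -/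

section SumPositivePart

variable {ι : Type*} {u : ι → ℝ} {S : Finset ι}

theorem sum_eq_sum_sub_add_card_mul (w : ι → ℝ) (d : ℝ) (W : Finset ι) :
    ∑ i ∈ W, w i = ∑ i ∈ W, (w i - d) + #W * d := by
  rw [Finset.sum_sub_distrib, Finset.sum_const, nsmul_eq_mul, sub_add_cancel]

theorem sum_sdiff_nonneg_of_mem_iff_pos [DecidableEq ι] (hS : ∀ i, i ∈ S ↔ 0 < u i) (W : Finset ι) :
    0 ≤ ∑ i ∈ S \ W, u i :=
  Finset.sum_nonneg fun i hi => ((hS i).1 (Finset.mem_sdiff.1 hi).1).le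

theorem sum_sdiff_nonpos_of_mem_iff_pos [DecidableEq ι] (hS : ∀ i, i ∈ S ↔ 0 < u i) (W : Finset ι) :
    ∑ i ∈ W \ S, u i ≤ 0 :=
  Finset.sum_nonpos fun i hi => not_lt.1 fun h => (Finset.mem_sdiff.1 hi).2 ((hS i).2 h)

theorem sum_le_sum_of_mem_iff_pos (hS : ∀ i, i ∈ S ↔ 0 < u i) (W : Finset ι) :
    ∑ i ∈ W, u i ≤ ∑ i ∈ S, u i := by
  classical
  linarith [Finset.sum_sdiff_sub_sum_sdiff (s₁ := S) (s₂ := W) (f := u),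
    sum_sdiff_nonneg_of_mem_iff_pos hS W, sum_sdiff_nonpos_of_mem_iff_pos hS W]

theorem sum_eq_sum_iff_of_mem_iff_pos [DecidableEq ι] (hS : ∀ i, i ∈ S ↔ 0 < u i) {W : Finset ι} :
    ∑ i ∈ W, u i = ∑ i ∈ S, u i ↔ S ⊆ W ∧ ∀ i ∈ W \ S, u i = 0 := by
  have nonneg := sum_sdiff_nonneg_of_mem_iff_pos hS W
  have nonpos := sum_sdiff_nonpos_of_mem_iff_pos hS W
  have diff_eq := Finset.sum_sdiff_sub_sum_sdiff (s₁ := S) (s₂ := W) (f := u)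
  constructor
  · intro heq
    have left_eq_zero : ∑ i ∈ S \ W, u i = 0 := by linarith
    have right_eq_zero : ∑ i ∈ W \ S, u i = 0 := by linarith
    refine ⟨fun i hi => by_contra fun hiW => ((hS i).1 hi).ne' ?_, ?_⟩
    · exact (Finset.sum_eq_zero_iff_of_nonneg fun j hj =>
        ((hS j).1 (Finset.mem_sdiff.1 hj).1).le).1 left_eq_zero i (Finset.mem_sdiff.2 ⟨hi, hiW⟩)
    · exact (Finset.sum_eq_zero_iff_of_nonpos fun j hj =>
        not_lt.1 fun h => (Finset.mem_sdiff.1 hj).2 ((hS j).2 h)).1 right_eq_zero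
  · rintro ⟨hSW, hzero⟩
    rw [Finset.sdiff_eq_empty_iff_subset.2 hSW, Finset.sum_empty, Finset.sum_eq_zero hzero]
      at diff_eq
    linarith

end SumPositivePart

/-- A level `d` at which `k` units run out: serving the agents in decreasing order of their weights
`w`, all agents of `S`, whose weights exceed `d`, get a unit, and the remaining units go to agents
of `T`, whose weights equal `d`. -/
structure IsCutoff {ι : Type*} (k : ℕ) (w : ι → ℝ) (d : ℝ) (S T : Finset ι) : Prop where
  nonneg : 0 ≤ d
  mem_left : ∀ i, i ∈ S ↔ d < w i
  mem_right : ∀ i, i ∈ T ↔ w i = d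
  card_left_le : #S ≤ k
  le_card_add_card : k ≤ #S + #T

theorem exists_isCutoff {ι : Type*} [Fintype ι] {k : ℕ} (hk : k < Fintype.card ι) {w : ι → ℝ}
    (hw : ∀ i, 0 ≤ w i) : ∃ j S T, IsCutoff k w (w j) S T ∧ k < #S + #T := by
  have : Nonempty ι := Fintype.card_pos_iff.1 (Nat.zero_lt_of_lt hk)
  have card_filter_le (j : ι) : #{i | w j < w i} + #{i | w i = w j} = #{i | w j ≤ w i} := by
    classical
    rw [← Finset.card_union_of_disjoint (Finset.disjoint_filter.2 fun i _ h h' => h.ne' h'),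
      ← Finset.filter_or]
    simp only [le_iff_lt_or_eq, eq_comm]
  obtain ⟨l, hl⟩ := Finite.exists_min w
  have exceeded : ∃ j, k < #{i | w j ≤ w i} :=
    ⟨l, by rwa [Finset.filter_true_of_mem fun i _ => hl i, Finset.card_univ]⟩
  obtain ⟨j, hj, hmax⟩ := Finset.exists_max_image {j | k < #{i | w j ≤ w i}} w
    (exceeded.imp fun j hj => Finset.mem_filter.2 ⟨Finset.mem_univ j, hj⟩)
  rw [Finset.mem_filter_univ] at hj
  refine ⟨j, ({i | w j < w i} : Finset ι), ({i | w i = w j} : Finset ι),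
    ⟨hw j, by simp, by simp, ?_, ?_⟩, ?_⟩
  · by_contra! hlt
    obtain ⟨m, hm, hmin⟩ := Finset.exists_min_image {i | w j < w i} w
      (Finset.card_pos.1 (Nat.zero_lt_of_lt hlt))
    have subset_ge : ({i | w j < w i} : Finset ι) ⊆ ({i | w m ≤ w i} : Finset ι) :=
      fun i hi => Finset.mem_filter.2 ⟨Finset.mem_univ i, hmin i hi⟩
    exact (hmax m (Finset.mem_filter.2 ⟨Finset.mem_univ m,
      hlt.trans_le (Finset.card_le_card subset_ge)⟩)).not_gt (Finset.mem_filter.1 hm).2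
  · rw [card_filter_le]
    exact hj.le
  · rwa [card_filter_le]

namespace IsCutoff

variable {ι : Type*} {k : ℕ} {w : ι → ℝ} {d x : ℝ} {S T : Finset ι} {i : ι}

theorem disjoint (h : IsCutoff k w d S T) : Disjoint S T :=
  Finset.disjoint_left.2 fun i hi hi' => ((h.mem_left i).1 hi).ne' ((h.mem_right i).1 hi')

theorem sum_le (h : IsCutoff k w d S T) {W : Finset ι} (hW : #W ≤ k) :
    ∑ i ∈ W, w i ≤ ∑ i ∈ S, (w i - d) + k * d := by
  rw [sum_eq_sum_sub_add_card_mul w d]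
  gcongr ?_ + ?_ * d
  · exact sum_le_sum_of_mem_iff_pos (fun i => by rw [h.mem_left, sub_pos]) W
  · exact h.nonneg
  · exact_mod_cast hW

variable [DecidableEq ι]

theorem mem_union (h : IsCutoff k w d S T) : i ∈ S ∪ T ↔ d ≤ w i := by
  rw [Finset.mem_union, h.mem_left, h.mem_right, le_iff_lt_or_eq, eq_comm (a := d)]

theorem update_of_lt_of_mem_left (h : IsCutoff k w d S T) (hi : i ∈ S) (hx : d < x) :
    IsCutoff k (Function.update w i x) d S T where
  __ := h
  mem_left j := by
    have := h.mem_left j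
    grind
  mem_right j := by
    have := h.mem_left j
    have := h.mem_right j
    grind

theorem update_of_eq_of_mem_left (h : IsCutoff k w d S T) (hi : i ∈ S) (hx : x = d) :
    IsCutoff k (Function.update w i x) d (S.erase i) (insert i T) where
  nonneg := h.nonneg
  mem_left j := by
    have := h.mem_left j
    grind
  mem_right j := by
    have := h.mem_right j
    grind
  card_left_le := Finset.card_erase_le.trans h.card_left_le
  le_card_add_card := by
    rw [Finset.card_insert_of_notMem (Finset.disjoint_left.1 h.disjoint hi)]
    linarith [h.le_card_add_card, Finset.card_erase_add_one hi]

theorem update_of_gt (h : IsCutoff k w d S T) (hlt : k < #S + #T) (i : ι) (hx : x < d) :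
    IsCutoff k (Function.update w i x) d (S.erase i) (T.erase i) where
  nonneg := h.nonneg
  mem_left j := by
    have := h.mem_left j
    grind
  mem_right j := by
    have := h.mem_right j
    grind
  card_left_le := Finset.card_erase_le.trans h.card_left_le
  le_card_add_card := by
    have card_le : #(S ∪ T) ≤ #((S ∪ T).erase i) + 1 := Nat.le_add_of_sub_le
      Finset.pred_card_le_card_erase
    rw [Finset.erase_union_distrib, Finset.card_union_of_disjoint h.disjoint,
      Finset.card_union_of_disjoint (h.disjoint.mono (S.erase_subset i) (T.erase_subset i))]
      at card_le
    exact Nat.le_of_lt_add_one (hlt.trans_le card_le)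

theorem sum_eq_iff (h : IsCutoff k w d S T) {W : Finset ι} (hW : #W = k) :
    ∑ i ∈ W, w i = ∑ i ∈ S, (w i - d) + k * d ↔ W ∈ priorityWinners (k - #S) S T := by
  rw [sum_eq_sum_sub_add_card_mul w d, hW, add_left_inj,
    sum_eq_sum_iff_of_mem_iff_pos fun i => by rw [h.mem_left, sub_pos],
    mem_priorityWinners h.disjoint, Nat.add_sub_cancel' h.card_left_le]
  simp only [hW, true_and, sub_eq_zero, ← h.mem_right, ← Finset.subset_iff]
  exact and_congr_right fun _ => sdiff_le_iff

theorem isMax_iff_mem_priorityWinners (h : IsCutoff k w d S T) {W : Finset ι} :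
    (#W = k ∧ ∀ W' : Finset ι, #W' ≤ k → ∑ i ∈ W', w i ≤ ∑ i ∈ W, w i) ↔
      W ∈ priorityWinners (k - #S) S T := by
  have card_eq {W : Finset ι} (hW : W ∈ priorityWinners (k - #S) S T) : #W = k := by
    rw [((mem_priorityWinners h.disjoint).1 hW).1, Nat.add_sub_cancel' h.card_left_le]
  constructor
  · rintro ⟨hW, hmax⟩
    obtain ⟨W₀, hW₀⟩ := priorityWinners_nonempty (S := S)
      (Nat.sub_le_iff_le_add'.2 h.le_card_add_card)
    refine (h.sum_eq_iff hW).1 ((h.sum_le hW.le).antisymm ?_)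
    rw [← (h.sum_eq_iff (card_eq hW₀)).2 hW₀]
    exact hmax W₀ (card_eq hW₀).le
  · intro hW
    refine ⟨card_eq hW, fun W' hW' => (h.sum_le hW').trans_eq ?_⟩
    exact ((h.sum_eq_iff (card_eq hW)).2 hW).symm

end IsCutoff

section MyeWinners

variable {n k : ℕ} {v : Fin n → ℝ} {d : ℝ} {S T : Finset (Fin n)}

theorem mem_myeWinners {D : Prior} {W : Finset (Fin n)} :
    W ∈ myeWinners D k v ↔ #W = min k n ∧ ∀ W' : Finset (Fin n), #W' ≤ k →
      ∑ i ∈ W', D.ironedValue (v i) ≤ ∑ i ∈ W, D.ironedValue (v i) := by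
  simp only [myeWinners, Finset.mem_filter_univ]

theorem myeWinners_of_le (D : Prior) (hk : n ≤ k) (v : Fin n → ℝ) :
    myeWinners D k v = {Finset.univ} := by
  ext W
  rw [mem_myeWinners, Finset.mem_singleton, min_eq_right hk]
  constructor
  · rintro ⟨card_eq, -⟩
    exact Finset.eq_univ_of_card W (card_eq.trans (Fintype.card_fin n).symm)
  · rintro rfl
    exact ⟨Finset.card_fin n, fun W' _ => Finset.sum_le_sum_of_subset_of_nonneg
      (Finset.subset_univ _) fun i _ _ => D.ironedValue_nonneg _⟩

theorem myeWinners_eq_priorityWinners {D : Prior}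
    (h : IsCutoff k (fun i => D.ironedValue (v i)) d S T) :
    myeWinners D k v = priorityWinners (k - #S) S T := by
  have hkn : k ≤ n := by
    calc k ≤ #S + #T := h.le_card_add_card
      _ = #(S ∪ T) := (Finset.card_union_of_disjoint h.disjoint).symm
      _ ≤ n := card_finset_fin_le _
  ext W
  rw [mem_myeWinners, min_eq_left hkn, h.isMax_iff_mem_priorityWinners]

end MyeWinners

/-! ### The allocation as a function of one bid -/

section Allocation

variable {n k : ℕ} {D : Prior} {v : Fin n → ℝ} {d z : ℝ} {S T : Finset (Fin n)} {i : Fin n}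

theorem myeAlloc_of_mem_left (h : IsCutoff k (fun i => D.ironedValue (v i)) d S T) (hi : i ∈ S) :
    myeAlloc D k v i = 1 := by
  rw [myeAlloc, myeWinners_eq_priorityWinners h, winProb_priorityWinners_of_mem_left
    (Nat.sub_le_iff_le_add'.2 h.le_card_add_card) hi]

theorem myeAlloc_of_mem_right (h : IsCutoff k (fun i => D.ironedValue (v i)) d S T) (hi : i ∈ T) :
    myeAlloc D k v i = ((k : ℝ) - #S) / #T := by
  rw [myeAlloc, myeWinners_eq_priorityWinners h, winProb_priorityWinners_of_mem_right h.disjoint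
    (Nat.sub_le_iff_le_add'.2 h.le_card_add_card) hi, Nat.cast_sub h.card_left_le]

theorem myeAlloc_of_notMem (h : IsCutoff k (fun i => D.ironedValue (v i)) d S T)
    (hi : i ∉ S ∪ T) : myeAlloc D k v i = 0 := by
  rw [myeAlloc, myeWinners_eq_priorityWinners h, winProb_priorityWinners_of_notMem hi]

theorem ironedValue_update (D : Prior) (v : Fin n → ℝ) (i : Fin n) (z : ℝ) :
    (fun j => D.ironedValue (Function.update v i z j)) =
      Function.update (fun j => D.ironedValue (v j)) i (D.ironedValue z) :=
  Function.comp_update D.ironedValue v i z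

theorem myeAlloc_update_of_gt (h : IsCutoff k (fun i => D.ironedValue (v i)) d S T)
    (hlt : k < #S + #T) (i : Fin n) (hz : D.ironedValue z < d) :
    myeAlloc D k (Function.update v i z) i = 0 := by
  have h' := h.update_of_gt hlt i hz
  rw [← ironedValue_update] at h'
  exact myeAlloc_of_notMem h' (by simp)

theorem myeAlloc_update_of_lt_of_mem_left
    (h : IsCutoff k (fun i => D.ironedValue (v i)) d S T) (hi : i ∈ S)
    (hz : d < D.ironedValue z) : myeAlloc D k (Function.update v i z) i = 1 := by
  have h' := h.update_of_lt_of_mem_left hi hz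
  rw [← ironedValue_update] at h'
  exact myeAlloc_of_mem_left h' hi

theorem myeAlloc_update_of_eq_of_mem_left
    (h : IsCutoff k (fun i => D.ironedValue (v i)) d S T) (hi : i ∈ S)
    (hz : D.ironedValue z = d) :
    myeAlloc D k (Function.update v i z) i = ((k : ℝ) - #S + 1) / (#T + 1) := by
  have h' := h.update_of_eq_of_mem_left hi hz
  rw [← ironedValue_update] at h'
  rw [myeAlloc_of_mem_right h' (Finset.mem_insert_self i T), Finset.cast_card_erase_of_mem hi,
    Finset.card_insert_of_notMem (Finset.disjoint_left.1 h.disjoint hi)]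
  push_cast
  ring

theorem myeAlloc_update_of_eq_of_mem_right
    (h : IsCutoff k (fun i => D.ironedValue (v i)) d S T) (hi : i ∈ T)
    (hz : D.ironedValue z = d) :
    myeAlloc D k (Function.update v i z) i = ((k : ℝ) - #S) / #T := by
  have value_eq : (fun j => D.ironedValue (Function.update v i z j)) =
      fun j => D.ironedValue (v j) := by
    rw [ironedValue_update, hz, ← (h.mem_right i).1 hi]
    exact Function.update_eq_self i _
  exact myeAlloc_of_mem_right (by rwa [value_eq]) hi

end Allocation

/-! ### Threshold bids -/

/-- Among the bids in `[0, B]`, those at which `φ` takes the value `d` form an interval with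
endpoints `q ≤ p`, below which `φ` is smaller and above which it is larger than `d`. Either
endpoint may or may not belong to the interval. -/
structure IsLevelInterval (φ : ℝ → ℝ) (B d q p : ℝ) : Prop where
  nonneg : 0 ≤ q
  le : q ≤ p
  lt_of_lt_left : ∀ z, 0 ≤ z → z < q → φ z < d
  le_of_left_lt : ∀ z, q < z → d ≤ φ z
  le_of_lt_right : ∀ z, z < p → φ z ≤ d
  lt_of_right_lt : ∀ z, p < z → z ≤ B → d < φ z

theorem exists_isLevelInterval {φ : ℝ → ℝ} (hφ : Monotone φ) {y B : ℝ} (hy : 0 ≤ y)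
    (hyB : y ≤ B) : ∃ q p, IsLevelInterval φ B (φ y) q p := by
  set Q := {z | 0 ≤ z ∧ φ y ≤ φ z}
  set P := {z | φ y < φ z ∨ B < z}
  have y_mem : y ∈ Q := ⟨hy, le_rfl⟩
  have bddBelow_Q : BddBelow Q := ⟨0, fun z hz => hz.1⟩
  have P_nonempty : P.Nonempty := ⟨B + 1, Or.inr (lt_add_one B)⟩
  have y_mem_lowerBounds : y ∈ lowerBounds P := fun z hz =>
    hz.elim (fun h => (hφ.reflect_lt h).le) fun h => hyB.trans h.le
  refine ⟨sInf Q, sInf P, le_csInf ⟨y, y_mem⟩ fun z hz => hz.1,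
    (csInf_le bddBelow_Q y_mem).trans (le_csInf P_nonempty y_mem_lowerBounds),
    fun z hz hzQ => ?_, fun z hz => ?_, fun z hzP => ?_, fun z hz hzB => ?_⟩
  · by_contra! hle
    exact hzQ.not_ge (csInf_le bddBelow_Q ⟨hz, hle⟩)
  · obtain ⟨x, hx, hxz⟩ := exists_lt_of_csInf_lt ⟨y, y_mem⟩ hz
    exact hx.2.trans (hφ hxz.le)
  · by_contra! hlt
    exact hzP.not_ge (csInf_le ⟨y, y_mem_lowerBounds⟩ (Or.inl hlt))
  · obtain ⟨x, hx, hxz⟩ := exists_lt_of_csInf_lt P_nonempty hz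
    exact (hx.resolve_right (hxz.trans_le hzB).not_gt).trans_le (hφ hxz.le)

theorem IsCutoff.isSplit {n k : ℕ} {v : Fin n → ℝ} {φ : ℝ → ℝ} {d q p B : ℝ}
    {S T : Finset (Fin n)} (hc : IsCutoff k (fun i => φ (v i)) d S T)
    (hl : IsLevelInterval φ B d q p) (hv : ∀ i, 0 ≤ v i) (hB : ∀ i, v i ≤ B) :
    IsSplit v p q S T where
  disjoint := hc.disjoint
  mem_of_gt_p i hi := (hc.mem_left i).2 (hl.lt_of_right_lt _ hi (hB i))
  ge_p_of_mem i hi := not_lt.1 fun h => (hl.le_of_lt_right _ h).not_gt ((hc.mem_left i).1 hi)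
  mem_of_gt_q i hi := hc.mem_union.2 (hl.le_of_left_lt _ hi)
  ge_q_of_mem i hi := not_lt.1 fun h =>
    (hl.lt_of_lt_left _ (hv i) h).not_ge (hc.mem_union.1 hi)
  symm i j hij := by simp only [hc.mem_left, hc.mem_right, hij, and_self]

/-! ### Payments -/

section PiecewiseConstant

variable {f : ℝ → ℝ} {a b c : ℝ}

theorem intervalIntegrable_of_eqOn_Ioo (hab : a ≤ b) (h : Set.EqOn f (fun _ => c) (Set.Ioo a b)) :
    IntervalIntegrable f volume a b :=
  (intervalIntegrable_congr_uIoo (by rwa [Set.uIoo_of_le hab])).2 intervalIntegrable_const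

theorem integral_of_eqOn_Ioo (hab : a ≤ b) (h : Set.EqOn f (fun _ => c) (Set.Ioo a b)) :
    ∫ z in a..b, f z = (b - a) * c := by
  rw [intervalIntegral.integral_congr_Ioo_of_le hab h, intervalIntegral.integral_const, smul_eq_mul]

end PiecewiseConstant

section Payment

variable {n k : ℕ} {D : Prior} {v : Fin n → ℝ} {d q p B : ℝ} {S T : Finset (Fin n)} {i : Fin n}

theorem integral_myeAlloc_of_mem_left (hc : IsCutoff k (fun i => D.ironedValue (v i)) d S T)
    (hlt : k < #S + #T) (hl : IsLevelInterval D.ironedValue B d q p) (hB : ∀ i, v i ≤ B)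
    (hi : i ∈ S) :
    ∫ z in (0 : ℝ)..v i, myeAlloc D k (Function.update v i z) i =
      (p - q) * (((k : ℝ) - #S + 1) / (#T + 1)) + (v i - p) := by
  set x := fun z => myeAlloc D k (Function.update v i z) i
  have hpv : p ≤ v i :=
    not_lt.1 fun h => (hl.le_of_lt_right _ h).not_gt ((hc.mem_left i).1 hi)
  have below : Set.EqOn x (fun _ => 0) (Set.Ioo 0 q) := fun z hz =>
    myeAlloc_update_of_gt hc hlt i (hl.lt_of_lt_left z hz.1.le hz.2)
  have between : Set.EqOn x (fun _ => ((k : ℝ) - #S + 1) / (#T + 1)) (Set.Ioo q p) := fun z hz =>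
    myeAlloc_update_of_eq_of_mem_left hc hi
      ((hl.le_of_lt_right z hz.2).antisymm (hl.le_of_left_lt z hz.1))
  have above : Set.EqOn x (fun _ => 1) (Set.Ioo p (v i)) := fun z hz =>
    myeAlloc_update_of_lt_of_mem_left hc hi (hl.lt_of_right_lt z hz.1 (hz.2.le.trans (hB i)))
  have integrable_below := intervalIntegrable_of_eqOn_Ioo hl.nonneg below
  have integrable_between := intervalIntegrable_of_eqOn_Ioo hl.le between
  rw [← intervalIntegral.integral_add_adjacent_intervals
      (integrable_below.trans integrable_between) (intervalIntegrable_of_eqOn_Ioo hpv above),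
    ← intervalIntegral.integral_add_adjacent_intervals integrable_below integrable_between,
    integral_of_eqOn_Ioo hl.nonneg below, integral_of_eqOn_Ioo hl.le between,
    integral_of_eqOn_Ioo hpv above, mul_zero, zero_add, mul_one]

theorem integral_myeAlloc_of_mem_right (hc : IsCutoff k (fun i => D.ironedValue (v i)) d S T)
    (hlt : k < #S + #T) (hl : IsLevelInterval D.ironedValue B d q p) (hv : 0 ≤ v i)
    (hi : i ∈ T) :
    ∫ z in (0 : ℝ)..v i, myeAlloc D k (Function.update v i z) i =
      (v i - q) * myeAlloc D k v i := by
  set x := fun z => myeAlloc D k (Function.update v i z) i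
  have value_eq : D.ironedValue (v i) = d := (hc.mem_right i).1 hi
  have hqv : q ≤ v i := not_lt.1 fun h => (hl.lt_of_lt_left _ hv h).ne value_eq
  have below : Set.EqOn x (fun _ => 0) (Set.Ioo 0 q) := fun z hz =>
    myeAlloc_update_of_gt hc hlt i (hl.lt_of_lt_left z hz.1.le hz.2)
  have above : Set.EqOn x (fun _ => ((k : ℝ) - #S) / #T) (Set.Ioo q (v i)) := fun z hz =>
    myeAlloc_update_of_eq_of_mem_right hc hi
      (((D.ironedValue_mono hz.2.le).trans value_eq.le).antisymm (hl.le_of_left_lt z hz.1))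
  rw [← intervalIntegral.integral_add_adjacent_intervals
      (intervalIntegrable_of_eqOn_Ioo hl.nonneg below) (intervalIntegrable_of_eqOn_Ioo hqv above),
    integral_of_eqOn_Ioo hl.nonneg below, integral_of_eqOn_Ioo hqv above, mul_zero, zero_add,
    myeAlloc_of_mem_right hc hi]

theorem mye_price_of_mem_left (hc : IsCutoff k (fun i => D.ironedValue (v i)) d S T)
    (hlt : k < #S + #T) (hl : IsLevelInterval D.ironedValue B d q p) (hB : ∀ i, v i ≤ B)
    (hi : i ∈ S) :
    (mye D k v).price i =
      ((k : ℝ) - #S + 1) / (#T + 1) * q + ((#S : ℝ) + #T - k) / (#T + 1) * p := by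
  have card_ne_zero : (#T : ℝ) + 1 ≠ 0 := by positivity
  simp only [mye, myePayment, integral_myeAlloc_of_mem_left hc hlt hl hB hi,
    myeAlloc_of_mem_left hc hi]
  field_simp
  ring

theorem mye_price_of_mem_right (hc : IsCutoff k (fun i => D.ironedValue (v i)) d S T)
    (hlt : k < #S + #T) (hl : IsLevelInterval D.ironedValue B d q p) (hv : 0 ≤ v i)
    (hi : i ∈ T) (halloc : myeAlloc D k v i ≠ 0) : (mye D k v).price i = q := by
  simp only [mye, myePayment, integral_myeAlloc_of_mem_right hc hlt hl hv hi]
  rw [div_eq_iff halloc]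
  ring

theorem mye_same_twoPriceOn (hc : IsCutoff k (fun i => D.ironedValue (v i)) d S T)
    (hlt : k < #S + #T) (hl : IsLevelInterval D.ironedValue B d q p) (hv : ∀ i, 0 ≤ v i)
    (hB : ∀ i, v i ≤ B) : (mye D k v).Same (twoPriceOn k S T p q) := by
  rw [twoPriceOn_of_le_of_lt hc.card_left_le hlt]
  refine ⟨myeWinners_eq_priorityWinners hc, fun W (hW : W ∈ myeWinners D k v) i hi => ?_⟩
  rw [myeWinners_eq_priorityWinners hc, mem_priorityWinners hc.disjoint,
    Nat.add_sub_cancel' hc.card_left_le] at hW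
  obtain ⟨card_eq, hSW, hWST⟩ := hW
  dsimp only
  split_ifs with hiS
  · exact mye_price_of_mem_left hc hlt hl hB hiS
  · have hiT : i ∈ T := (Finset.mem_union.1 (hWST hi)).resolve_left hiS
    have card_lt : #S < k := card_eq ▸ Finset.card_lt_card ⟨hSW, fun h => hiS (h hi)⟩
    refine mye_price_of_mem_right hc hlt hl (hv i) hiT ?_
    rw [myeAlloc_of_mem_right hc hiT]
    exact div_ne_zero (sub_ne_zero.2 (Nat.cast_lt.2 card_lt).ne')
      (Nat.cast_ne_zero.2 (Finset.card_ne_zero_of_mem hiT))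

end Payment

/-! ### The optimal mechanism is a two-price lottery -/

section MyeSame

variable {n k : ℕ} {v : Fin n → ℝ}

theorem mye_same_of_le (D : Prior) (hk : n ≤ k) (v : Fin n → ℝ) :
    (mye D k v).Same (twoPriceOn k Finset.univ ∅ 0 0) := by
  have alloc_eq_one (u : Fin n → ℝ) (i : Fin n) : myeAlloc D k u i = 1 := by
    rw [myeAlloc, myeWinners_of_le D hk]
    exact winProb_eq_one (Finset.singleton_nonempty _) (by simp)
  rw [twoPriceOn, if_neg (by simpa using hk), if_pos (by simpa using hk), Finset.union_empty]
  refine ⟨myeWinners_of_le D hk v, fun W _ i _ => ?_⟩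
  simp only [mye, myePayment, alloc_eq_one, intervalIntegral.integral_const, smul_eq_mul, mul_one,
    sub_zero, sub_self, zero_div]

theorem isSplit_univ_empty (hv : ∀ i, 0 ≤ v i) : IsSplit v 0 0 Finset.univ ∅ where
  disjoint := Finset.disjoint_empty_right _
  mem_of_gt_p _ _ := Finset.mem_univ _
  ge_p_of_mem i _ := hv i
  mem_of_gt_q _ _ := Finset.mem_union_left _ (Finset.mem_univ _)
  ge_q_of_mem i _ := hv i
  symm i j _ := by simp only [Finset.mem_univ, Finset.notMem_empty, and_self]

theorem exists_isSplit_mye_same (D : Prior) (k : ℕ) (hv : ∀ i, 0 ≤ v i) :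
    ∃ p q : ℝ, 0 ≤ q ∧ q ≤ p ∧ ∃ S T : Finset (Fin n),
      IsSplit v p q S T ∧ (mye D k v).Same (twoPriceOn k S T p q) := by
  rcases le_or_gt n k with hk | hk
  · exact ⟨0, 0, le_rfl, le_rfl, Finset.univ, ∅, isSplit_univ_empty hv, mye_same_of_le D hk v⟩
  obtain ⟨B, hB⟩ := (Set.finite_range v).bddAbove
  rw [mem_upperBounds, Set.forall_mem_range] at hB
  obtain ⟨j, S, T, hc, hlt⟩ := exists_isCutoff (by rwa [Fintype.card_fin])
    fun i => D.ironedValue_nonneg (v i)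
  obtain ⟨q, p, hl⟩ := exists_isLevelInterval D.ironedValue_mono (hv j) (hB j)
  exact ⟨p, q, hl.nonneg, hl.le, S, T, hc.isSplit hl hv hB, mye_same_twoPriceOn hc hlt hl hv hB⟩

end MyeSame

/-! ### The benchmark -/

section Benchmark

variable {n : ℕ} {v : Fin n → ℝ}

theorem mye_surplus_nonneg (D : Prior) (k : ℕ) (hv : ∀ i, 0 ≤ v i) :
    0 ≤ (mye D k v).surplus v := by
  obtain ⟨p, q, -, hqp, S, T, split, same⟩ := exists_isSplit_mye_same D k hv
  rw [same.surplus_eq, twoPriceOn_surplus k split.disjoint]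
  exact split.splitSurplus_nonneg k hqp

theorem exists_forall_mye_surplus_le_pqLottery (k : ℕ) (hv : ∀ i, 0 ≤ v i) :
    ∃ p q : ℝ, 0 ≤ q ∧ q ≤ p ∧
      ∀ D : Prior, (mye D k v).surplus v ≤ (pqLottery k p q v).surplus v := by
  obtain ⟨p, q, hq, hqp, hmax⟩ := exists_forall_pqLottery_surplus_le k v
  refine ⟨p, q, hq, hqp, fun D => ?_⟩
  obtain ⟨p', q', hq', hqp', S, T, split, same⟩ := exists_isSplit_mye_same D k hv
  rw [same.surplus_eq, twoPriceOn_surplus k split.disjoint]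
  exact (split.splitSurplus_le k hqp').trans (hmax p' q' hq' hqp')

theorem isLUB_benchmark (k : ℕ) (hv : ∀ i, 0 ≤ v i) :
    IsLUB (Set.range fun D : Prior => (mye D k v).surplus v) (benchmark k v) :=
  let ⟨_, _, _, _, hle⟩ := exists_forall_mye_surplus_le_pqLottery k hv
  isLUB_ciSup ⟨_, Set.forall_mem_range.2 hle⟩

theorem benchmark_nonneg (k : ℕ) (hv : ∀ i, 0 ≤ v i) : 0 ≤ benchmark k v :=
  Real.iSup_nonneg fun D => mye_surplus_nonneg D k hv

theorem exists_pqLottery_surplus_eq_benchmark (k : ℕ) (hv : ∀ i, 0 ≤ v i) :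
    ∃ p q : ℝ, 0 ≤ q ∧ q ≤ p ∧ (pqLottery k p q v).surplus v = benchmark k v := by
  obtain ⟨p, q, hq, hqp, hle⟩ := exists_forall_mye_surplus_le_pqLottery k hv
  obtain ⟨p', q', hqq', hqp', heq⟩ :=
    exists_pqLottery_surplus_eq k hqp (benchmark_nonneg k hv) (ciSup_le hle)
  exact ⟨p', q', hq.trans hqq', hqp', heq⟩

end Benchmark

end MoneyBurning

theorem mainTheorem6 (n k : ℕ) (v : Fin n → ℝ) (hv : ∀ i, 0 ≤ v i) :
    -- each optimal mechanism coincides ex post with a two-price lottery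
    (∀ D : MoneyBurning.Prior, ∃ p q : ℝ, 0 ≤ q ∧ q ≤ p ∧ ∃ S T : Finset (Fin n),
      MoneyBurning.IsSplit v p q S T ∧
      (MoneyBurning.mye D k v).Same (MoneyBurning.twoPriceOn k S T p q)) ∧
    -- the benchmark is a genuine supremum, and is the surplus of some `(p,q)`-lottery
    IsLUB (Set.range fun D : MoneyBurning.Prior => (MoneyBurning.mye D k v).surplus v)
      (MoneyBurning.benchmark k v) ∧
    (∃ p q : ℝ, 0 ≤ q ∧ q ≤ p ∧
      (MoneyBurning.pqLottery k p q v).surplus v = MoneyBurning.benchmark k v) ∧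
    -- comparison of the `(p,q)`-lottery with single-price lotteries
    (∀ p q : ℝ, 0 ≤ q → q ≤ p →
      (MoneyBurning.pqLottery k p q v).surplus v ≤
        (MoneyBurning.pqLottery k p p v).surplus v +
          (MoneyBurning.pqLottery k q q v).surplus v) ∧
    (∀ p q : ℝ, 0 ≤ q → q ≤ p → (∀ i, v i ≠ p ∧ v i ≠ q) →
      (MoneyBurning.pqLottery k p q v).surplus v ≤
        (MoneyBurning.pLottery k p v).surplus v + (MoneyBurning.pLottery k q v).surplus v) ∧
    (∀ p q : ℝ, 0 ≤ q → q ≤ p → ∃ p' : ℝ, 0 ≤ p' ∧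
      (MoneyBurning.pqLottery k p q v).surplus v / 2 ≤
        (MoneyBurning.pLottery k p' v).surplus v) ∧
    -- some single-price lottery obtains half of the benchmark
    (∃ p : ℝ, 0 ≤ p ∧
      MoneyBurning.benchmark k v / 2 ≤ (MoneyBurning.pLottery k p v).surplus v) := by
  refine ⟨fun D => MoneyBurning.exists_isSplit_mye_same D k hv, MoneyBurning.isLUB_benchmark k hv,
    MoneyBurning.exists_pqLottery_surplus_eq_benchmark k hv,
    fun p q _ hqp => MoneyBurning.pqLottery_surplus_le_add k v hqp, fun p q _ hqp hne => ?_,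
    fun p q hq hqp => ?_, ?_⟩
  · rw [MoneyBurning.pLottery_surplus_of_forall_ne k fun i => (hne i).1,
      MoneyBurning.pLottery_surplus_of_forall_ne k fun i => (hne i).2]
    exact MoneyBurning.pqLottery_surplus_le_add k v hqp
  · obtain ⟨p', hp', hle⟩ := MoneyBurning.exists_pLottery_surplus_ge_half k v hqp
    exact ⟨p', hq.trans hp', hle⟩
  · obtain ⟨p, q, hq, hqp, heq⟩ := MoneyBurning.exists_pqLottery_surplus_eq_benchmark k hv
    obtain ⟨p', hp', hle⟩ := MoneyBurning.exists_pLottery_surplus_ge_half k v hqp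
    exact ⟨p', hq.trans hp', heq ▸ hle⟩
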